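/- Let $\alpha\in\mathbb R$, $\alpha\neq 0,1$. Consider a semi-discrete system $$u_{1x}=f(x,n,u,v,u_x,v_x,u_1,v_1),\qquad v_{1x}=g(x,n,u,v,u_x,v_x,u_1,v_1),$$ for real functions $u=u(x,n)$, $v=v(x,n)$ of $x\in\mathbb R$, $n\in\mathbb N$, where $u_1=u(x,n+1)$, $v_1=v(x,n+1)$, and where for each $n$ the functions $f,g$ are $C^\infty$ on an open set $\Omega_n$ of values $(x,u,v,u_x,v_x,u_1,v_1)$ with $u_x/(u+v)>0$ and $u_1+v_1\ne0$, such that for fixed $(u,v,u_1,v_1)$ the set of $(x,u_x,v_x)$ with $(x,u,v,u_x,v_x,u_1,v_1)\in\Omega_n$ is connected or empty. A function $J(x,n,u,v,u_x,v_x,u_{xx},v_{xx})$ is called an $n$-integral of the system if on every local solution on which $J$ is defined the shifted function $DJ$ (all $n$ replaced by $n+1$) is defined too and $DJ=J$. Real powers are taken of positive numbers only. Then the functions $$I_1=\Bigl(1+\frac1\alpha\Bigr)v\Bigl(\frac{u_x}{u+v}\Bigr)^{1-\alpha}-v_x\Bigl(\frac{u_x}{u+v}\Bigr)^{-\alpha},\qquad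 J_1=\frac{u_{xx}}{u_x}-\frac{(\alpha+1)u_x+\alpha v_x}{\alpha(u+v)}$$ are both $n$-integrals of the system if and only if the system has the form $$u_{1x}=\frac{u_1+v_1}{u+v}\,\mathcal D_1^{1/\alpha}u_x,\qquad v_{1x}=\frac{\alpha+1}{\alpha}\,\frac{v_1\mathcal D_1^{1/\alpha}-v\mathcal D_1}{u+v}\,u_x+\mathcal D_1v_x ,$$ where, for each $n$, $\mathcal D_1=\mathcal D_1(u,v,u_1,v_1)>0$ is a $C^\infty$ function on the projection of $\Omega_n$ to the variables $(u,v,u_1,v_1)$ and at each point of this projection either $\mathcal D_1=1$, or $\mathcal D_1$ is given implicitly near the point by an equation $H(K_1,L_1)=0$. Here $H:\mathbb R^2\to\mathbb R$ is a $C^\infty$ function, the equation holds in a neighbourhood of the point, the derivative of $H(K_1,L_1)$ with respect to $\mathcal D_1$ is nonzero at the point, and, with $E=\mathcal D_1^{1/\alpha}$ and $Q=\alpha v_1E-\alpha v\mathcal D_1E+(1-E)u_1$, $$K_1=\frac{Q}{(E-1)|E-1|^{\alpha}},\qquad L_1=\frac{u_1-\mathcal D_1E\,u}{E\,|E-1|^{\alpha}}+\frac{Q}{E\,(E-1)|E-1|^{\alpha}}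 .$$ -/

import Mathlib

open Set Filter Topology
open scoped ContDiff

noncomputable section

namespace SemiDiscrete

/-- The pair `q = (u, v)` of dependent variables (or of their derivatives or shifts). -/
abbrev Pair := ℝ × ℝ

/-- The variables `(x, (u, v), (u_x, v_x), (u₁, v₁))` on which, besides `n`, the right-hand sides
of a semi-discrete system depend; `u₁, v₁` are the values of `u, v` at `n + 1`. -/
abbrev Site := ℝ × Pair × Pair × Pair

/-- Second-order jets `((u, v), (u_x, v_x), (u_xx, v_xx))` in `x`, at one value of `n`. -/
abbrev Jet := Pair × Pair × Pair

/-- The site of the pair of functions `u(x, n), v(x, n)` at `(x, n)`. -/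
def siteOf (u v : ℕ → ℝ → ℝ) (n : ℕ) (x : ℝ) : Site :=
  (x, (u n x, v n x), (deriv (u n) x, deriv (v n) x), (u (n + 1) x, v (n + 1) x))

/-- The second-order jet in `x` of the pair of functions `u(x, n), v(x, n)` at `(x, n)`. -/
def jetOf (u v : ℕ → ℝ → ℝ) (n : ℕ) (x : ℝ) : Jet :=
  ((u n x, v n x), (deriv (u n) x, deriv (v n) x), (deriv (deriv (u n)) x, deriv (deriv (v n)) x))

/-- `u(x, n), v(x, n)`, for `x` in the open set `s` and `a ≤ n ≤ b`, is a (classical, local)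
solution of `u_{1x} = f(x, n, u, v, u_x, v_x, u₁, v₁)`, `v_{1x} = g(x, n, u, v, u_x, v_x, u₁, v₁)`,
where `f n` and `g n` have the domain `Ω n`. -/
structure IsSolutionOn (f g : ℕ → Site → ℝ) (Ω : ℕ → Set Site) (a b : ℕ) (s : Set ℝ)
    (u v : ℕ → ℝ → ℝ) : Prop where
  isOpen : IsOpen s
  contDiffOn_u : ∀ n ∈ Icc a b, ContDiffOn ℝ 2 (u n) s
  contDiffOn_v : ∀ n ∈ Icc a b, ContDiffOn ℝ 2 (v n) s
  mem_domain : ∀ n ∈ Ico a b, ∀ x ∈ s, siteOf u v n x ∈ Ω n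
  eq_u : ∀ n ∈ Ico a b, ∀ x ∈ s, deriv (u (n + 1)) x = f n (siteOf u v n x)
  eq_v : ∀ n ∈ Ico a b, ∀ x ∈ s, deriv (v (n + 1)) x = g n (siteOf u v n x)

/-- `J`, a function of `x, n` and second-order jets that is defined for jets in `dom`, is an
`n`-integral of the system: on every solution along which `J` is defined at `n`, the shifted
function `DJ` is defined too and `DJ = J`. -/
def IsNIntegral (f g : ℕ → Site → ℝ) (Ω : ℕ → Set Site) (dom : Set Jet)
    (J : ℝ → ℕ → Jet → ℝ) : Prop :=
  ∀ (a b : ℕ) (s : Set ℝ) (u v : ℕ → ℝ → ℝ), IsSolutionOn f g Ω a b s u v →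
    ∀ n ∈ Ico a b, ∀ x ∈ s, jetOf u v n x ∈ dom →
      jetOf u v (n + 1) x ∈ dom ∧ J x (n + 1) (jetOf u v (n + 1) x) = J x n (jetOf u v n x)

/-- Where the real powers of `u_x / (u + v)` make sense. -/
def domI : Set Jet := {j | 0 < j.2.1.1 / (j.1.1 + j.1.2)}

/-- `I₁ = (1 + 1/α) v (u_x/(u+v))^(1-α) - v_x (u_x/(u+v))^(-α)`. -/
def I₁ (α : ℝ) : ℝ → ℕ → Jet → ℝ := fun _ _ ((u, v), (ux, vx), _) =>
  (1 + 1 / α) * v * (ux / (u + v)) ^ (1 - α) - vx * (ux / (u + v)) ^ (-α)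

/-- Where the quotients in `J₁` make sense. -/
def domJ : Set Jet := {j | j.2.1.1 ≠ 0 ∧ j.1.1 + j.1.2 ≠ 0}

/-- `J₁ = u_xx/u_x - ((α+1) u_x + α v_x)/(α (u+v))`. -/
def J₁ (α : ℝ) : ℝ → ℕ → Jet → ℝ := fun _ _ ((u, v), (ux, vx), (uxx, _)) =>
  uxx / ux - ((α + 1) * ux + α * vx) / (α * (u + v))

/-- `K₁`, as a function of `((u, v), (u₁, v₁))` and of the value `d` of `𝒟₁`. The real power
`(E - 1)^(α + 1)`, `E = d^(1/α)`, is written `(E - 1) * |E - 1|^α`, so that it makes sense for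
`E < 1` too (there it is a constant multiple of any branch of the power). -/
def K₁ (α : ℝ) : Pair × Pair → ℝ → ℝ := fun ((_, v), (u₁, v₁)) d =>
  (α * v₁ * d ^ (1 / α) - α * v * d ^ (1 + 1 / α) + (1 - d ^ (1 / α)) * u₁) /
    ((d ^ (1 / α) - 1) * |d ^ (1 / α) - 1| ^ α)

/-- `L₁`, as a function of `((u, v), (u₁, v₁))` and of the value `d` of `𝒟₁`. -/
def L₁ (α : ℝ) : Pair × Pair → ℝ → ℝ := fun ((u, v), (u₁, v₁)) d =>
  (u₁ - d ^ (1 + 1 / α) * u) / (d ^ (1 / α) * |d ^ (1 / α) - 1| ^ α) +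
    (α * v₁ * d ^ (1 / α) - α * v * d ^ (1 + 1 / α) + (1 - d ^ (1 / α)) * u₁) /
      (d ^ (1 / α) * ((d ^ (1 / α) - 1) * |d ^ (1 / α) - 1| ^ α))

/-- Near `w`, the function `D` of `w = ((u, v), (u₁, v₁))` is given implicitly by the equation
`H(K₁, L₁) = 0` for the unknown `𝒟₁`: the equation holds with `𝒟₁ = D` near `w`, and it is
nondegenerate in `𝒟₁` at `w`, as in the implicit function theorem. -/
def IsImplicitNear (α : ℝ) (H : ℝ × ℝ → ℝ) (D : Pair × Pair → ℝ) (w : Pair × Pair) : Prop :=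
  (∀ᶠ w' in 𝓝 w, H (K₁ α w' (D w'), L₁ α w' (D w')) = 0) ∧
    deriv (fun d => H (K₁ α w d, L₁ α w d)) (D w) ≠ 0

/-- The values `((u, v), (u₁, v₁))` that occur in a set of sites. -/
def baseOf (S : Set Site) : Set (Pair × Pair) :=
  {w | ∃ (x : ℝ) (qx : Pair), (x, w.1, qx, w.2) ∈ S}

/-- The explicit form of the right-hand sides:
`f = (u₁+v₁)/(u+v) 𝒟₁^(1/α) u_x`,
`g = (α+1)/α (v₁ 𝒟₁^(1/α) - v 𝒟₁)/(u+v) u_x + 𝒟₁ v_x`, on the set `S` of sites. -/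
def HasForm (α : ℝ) (f g : Site → ℝ) (S : Set Site) (D : Pair × Pair → ℝ) : Prop :=
  ∀ x u v ux vx u₁ v₁ : ℝ, (x, (u, v), (ux, vx), (u₁, v₁)) ∈ S →
    f (x, (u, v), (ux, vx), (u₁, v₁)) =
        (u₁ + v₁) / (u + v) * D ((u, v), (u₁, v₁)) ^ (1 / α) * ux ∧
    g (x, (u, v), (ux, vx), (u₁, v₁)) =
        (α + 1) / α * ((v₁ * D ((u, v), (u₁, v₁)) ^ (1 / α) - v * D ((u, v), (u₁, v₁))) / (u + v))
            * ux + D ((u, v), (u₁, v₁)) * vx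

end SemiDiscrete

end

/-!
Write `E = 𝒟₁^(1/α)`, `p = u_x / (u + v)` and `p₁ = u_{1x} / (u₁ + v₁)`.

The equation `DI₁ = I₁` is algebraic: with `𝒟₁ := (p₁ / p)^α` it is equivalent to the stated formula
for `v_{1x}` (`I₁_shift_iff`), while the formula for `u_{1x}` is the definition of `𝒟₁`. The equation
`DJ₁ = J₁` says that `𝒟₁` has derivative `p 𝒟₁ (E - 1)` along every solution (`J₁_shift_iff`).

Every site and every value of `(u_xx, v_xx)` occur on a local solution (`exists_isSolutionOn`), so if
`I₁` and `J₁` are `n`-integrals, the second equation is an identity in `(u_xx, v_xx)`, and then in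
`(u_x, v_x)`. Hence `𝒟₁` does not depend on `x, u_x, v_x`, the fibres being connected, and it solves
the quasilinear system `X 𝒟₁ = 0`, `Y 𝒟₁ = 𝒟₁ (E - 1)` of `SolvesPDE`. Conversely, the velocity of
`(u, v, u₁, v₁)` along a solution of a system of the explicit form is `p Y + v_x X`, so this
quasilinear system gives back `DJ₁ = J₁`.

It remains to solve the quasilinear system. In the five variables `u, v, u₁, v₁, 𝒟₁` the fields `X`
and `Y + 𝒟₁ (E - 1) ∂_{𝒟₁}` and their bracket `Z` annihilate `K₁` and `L₁`. Differentiating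
`H (K₁, L₁) = 0` along these fields shows that an implicitly given function is a solution
(`IsImplicitNear.solvesPDE`); points with `𝒟₁ = 1` are limits of points with `𝒟₁ ≠ 1`, or `𝒟₁ = 1`
near them. Conversely, along the graph of a solution with `𝒟₁ ≠ 1` the differentials of `K₁` and `L₁`
vanish on the three fields `X`, `Y`, `Z`, which are independent in the four-dimensional space of
`(u, v, u₁, v₁)`. So these differentials are proportional; they are not both zero, and by the
constant rank theorem (`exists_contDiff_eventually_eq_comp`) one of `K₁, L₁` is a smooth function of
the other one (`exists_isImplicitNear`).
-/

noncomputable section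

namespace SemiDiscrete

/-! ### Smooth functional dependence -/

/-- A function that is smooth near a point agrees near that point with a function that is smooth on
the whole line. -/
theorem exists_contDiff_eventuallyEq {φ : ℝ → ℝ} {t₀ : ℝ}
    (hφ : ∀ᶠ t in 𝓝 t₀, ContDiffAt ℝ ∞ φ t) :
    ∃ ψ : ℝ → ℝ, ContDiff ℝ ∞ ψ ∧ ψ =ᶠ[𝓝 t₀] φ := by
  obtain ⟨r, hr, hball⟩ := Metric.eventually_nhds_iff_ball.1 hφ
  let χ : ContDiffBump t₀ := ⟨r / 4, r / 2, by positivity, by linarith⟩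
  refine ⟨fun t => χ t * φ t, contDiff_iff_contDiffAt.2 fun t => ?_, ?_⟩
  · by_cases ht : t ∈ Metric.ball t₀ r
    · exact χ.contDiff.contDiffAt.mul (hball t ht)
    · have ht' : t ∉ tsupport χ := by
        rw [χ.tsupport_eq]
        intro h
        exact ht (Metric.closedBall_subset_ball (by change r / 2 < r; linarith) h)
      have h0 : (fun s => χ s * φ s) =ᶠ[𝓝 t] fun _ => 0 := by
        filter_upwards [notMem_tsupport_iff_eventuallyEq.1 ht'] with s hs
        simp [hs]
      exact contDiffAt_const.congr_of_eventuallyEq h0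
  · filter_upwards [χ.eventuallyEq_one] with t ht
    simp [ht]

/-- A special case of the constant rank theorem: if `k` is a submersion at `w` and, near `w`, the
derivative of `l` vanishes on the kernel of that of `k`, then `l` is a smooth function of `k`. -/
theorem exists_contDiff_eventually_eq_comp {F : Type*} [NormedAddCommGroup F] [NormedSpace ℝ F]
    [CompleteSpace F] {k l : F → ℝ} {w : F}
    (hk : ∀ᶠ y in 𝓝 w, ContDiffAt ℝ ∞ k y) (hl : ∀ᶠ y in 𝓝 w, ContDiffAt ℝ ∞ l y)
    (hne : fderiv ℝ k w ≠ 0)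
    (hker : ∀ᶠ y in 𝓝 w, ∀ v, fderiv ℝ k y v = 0 → fderiv ℝ l y v = 0) :
    ∃ φ : ℝ → ℝ, ContDiff ℝ ∞ φ ∧ ∀ᶠ y in 𝓝 w, l y = φ (k y) := by
  set ℓ := fderiv ℝ k w with hℓ
  obtain ⟨e, he⟩ : ∃ e, ℓ e = 1 := by
    obtain ⟨e, he⟩ := ContinuousLinearMap.exists_ne_zero hne
    exact ⟨(ℓ e)⁻¹ • e, by simp [he]⟩
  -- `Φ` straightens `k`: its derivative at `w` is the identity and `ℓ ∘ Φ` is `k` up to a constant.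
  let Φ : F → F := fun y => y + (k y - k w - ℓ (y - w)) • e
  have hΦsmooth : ∀ y, ContDiffAt ℝ ∞ k y → ContDiffAt ℝ ∞ Φ y := fun y hy => by
    have : ContDiffAt ℝ ∞ (fun y => ℓ (y - w)) y := by fun_prop
    exact contDiffAt_id.add (((hy.sub contDiffAt_const).sub this).smul contDiffAt_const)
  have hΦw : Φ w = w := by simp [Φ]
  have hℓΦ : ∀ y, ℓ (Φ y - w) = k y - k w := fun y => by
    simp [Φ, he]
    ring
  have hℓd : ∀ z, HasFDerivAt (fun y => ℓ (y - w)) ℓ z := fun z =>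
    ℓ.hasFDerivAt.comp z ((hasFDerivAt_id z).sub_const w)
  have hΦd : HasFDerivAt Φ (ContinuousLinearEquiv.refl ℝ F : F →L[ℝ] F) w := by
    have h1 : HasFDerivAt k ℓ w := (hk.self_of_nhds.differentiableAt (by simp)).hasFDerivAt
    have h3 := (hasFDerivAt_id w).add (((h1.sub_const (k w)).sub (hℓd w)).smul_const e)
    convert! h3 using 1
    ext v
    simp
  let P := (hΦsmooth w hk.self_of_nhds).toOpenPartialHomeomorph Φ hΦd (by simp)
  have hPcoe : ∀ y, P y = Φ y := fun _ => rfl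
  have hws : w ∈ P.source := ContDiffAt.mem_toOpenPartialHomeomorph_source _ _ _
  have hwt : w ∈ P.target := by
    have := P.map_source hws
    rwa [hPcoe, hΦw] at this
  have hsw : P.symm w = w := by
    have := P.left_inv hws
    rwa [hPcoe, hΦw] at this
  have hinv : ∀ᶠ y in 𝓝 w, fderiv ℝ Φ y ∈ range ((↑) : (F ≃L[ℝ] F) → F →L[ℝ] F) := by
    have hc : ContinuousAt (fderiv ℝ Φ) w :=
      ((hΦsmooth w hk.self_of_nhds).fderiv_right (m := 0) (by simp)).continuousAt
    refine hc.eventually_mem ?_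
    rw [hΦd.fderiv]
    exact ContinuousLinearEquiv.nhds _
  have htend : Tendsto P.symm (𝓝 w) (𝓝 w) := by
    have := P.continuousAt_symm hwt
    rwa [ContinuousAt, hsw] at this
  have hgood : ∀ᶠ z in 𝓝 w, z ∈ P.target ∧ ContDiffAt ℝ ∞ P.symm z ∧
      ContDiffAt ℝ ∞ k (P.symm z) ∧ ContDiffAt ℝ ∞ l (P.symm z) ∧
      ∀ v, fderiv ℝ k (P.symm z) v = 0 → fderiv ℝ l (P.symm z) v = 0 := by
    filter_upwards [P.open_target.mem_nhds hwt, htend.eventually hk, htend.eventually hl,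
      htend.eventually hker, htend.eventually hinv] with z hz hkz hlz hkerz ⟨f', hf'⟩
    refine ⟨hz, P.contDiffAt_symm (f₀' := f') hz ?_ (hΦsmooth _ hkz), hkz, hlz, hkerz⟩
    rw [hf']
    exact ((hΦsmooth _ hkz).differentiableAt (by simp)).hasFDerivAt
  obtain ⟨r, hr, hball⟩ := Metric.eventually_nhds_iff_ball.1 hgood
  let σ : ℝ → F := fun t => w + (t - k w) • e
  have hσc : Continuous σ := by fun_prop
  have hσw : σ (k w) = w := by simp [σ]
  have hσt : Tendsto σ (𝓝 (k w)) (𝓝 w) := by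
    have := hσc.tendsto (k w)
    rwa [hσw] at this
  have hball' : Metric.ball w r ∈ 𝓝 w := Metric.ball_mem_nhds w hr
  obtain ⟨φ, hφ, hφeq⟩ := exists_contDiff_eventuallyEq
    (φ := fun t => l (P.symm (σ t))) (t₀ := k w) (by
      filter_upwards [hσt hball'] with t ht
      obtain ⟨-, h1, -, h2, -⟩ := hball _ ht
      have hσs : ContDiffAt ℝ ∞ σ t := by fun_prop
      exact h2.comp t (h1.comp t hσs))
  refine ⟨φ, hφ, ?_⟩
  have hkc : Tendsto k (𝓝 w) (𝓝 (k w)) := hk.self_of_nhds.continuousAt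
  have hΦt : Tendsto Φ (𝓝 w) (𝓝 w) := by
    have := (hΦsmooth w hk.self_of_nhds).continuousAt.tendsto
    rwa [hΦw] at this
  filter_upwards [hkc.eventually hφeq, (hσt.comp hkc) hball', hΦt hball',
    P.open_source.mem_nhds hws] with y hy hσy hΦy hys
  rw [hy]
  -- On the ball, `l ∘ Φ⁻¹` is constant along the segment from `Φ y` to `σ (k y)`, on which `ℓ` is
  -- constant.
  have hseg : segment ℝ (Φ y) (σ (k y)) ⊆ Metric.ball w r :=
    (convex_ball w r).segment_subset hΦy hσy
  set d := σ (k y) - Φ y with hd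
  have hℓ0 : ℓ d = 0 := by
    have h1 : ℓ (σ (k y) - w) = k y - k w := by simp [σ, he]
    have h2 := hℓΦ y
    have : d = (σ (k y) - w) - (Φ y - w) := by rw [hd]; abel
    rw [this, map_sub, h1, h2, sub_self]
  have hconst : ∀ s ∈ Icc (0 : ℝ) 1,
      HasDerivWithinAt (fun s : ℝ => l (P.symm (Φ y + s • d))) 0 (Icc 0 1) s := by
    intro s hs
    have hz : Φ y + s • d ∈ Metric.ball w r := hseg (by
      rw [segment_eq_image']
      exact ⟨s, hs, rfl⟩)
    obtain ⟨hzt, h1, h2, h3, h4⟩ := hball _ hz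
    set z := Φ y + s • d with hzdef
    have hline : HasDerivAt (fun s : ℝ => Φ y + s • d) d s := by
      simpa using ((hasDerivAt_id s).smul_const d).const_add (Φ y)
    have hP : HasFDerivAt P.symm (fderiv ℝ P.symm z) z :=
      (h1.differentiableAt (by simp)).hasFDerivAt
    have hl' : HasFDerivAt l (fderiv ℝ l (P.symm z)) (P.symm z) :=
      (h3.differentiableAt (by simp)).hasFDerivAt
    have hk' : HasFDerivAt k (fderiv ℝ k (P.symm z)) (P.symm z) :=
      (h2.differentiableAt (by simp)).hasFDerivAt
    have hkz : HasFDerivAt (fun z => k (P.symm z)) ℓ z := by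
      have h5 : (fun z => k (P.symm z)) =ᶠ[𝓝 z] fun z => ℓ (z - w) + k w := by
        filter_upwards [P.open_target.mem_nhds hzt] with x hx
        have := hℓΦ (P.symm x)
        rw [← hPcoe, P.right_inv hx] at this
        linarith
      exact ((hℓd z).add_const (k w)).congr_of_eventuallyEq h5
    have hkd : fderiv ℝ k (P.symm z) (fderiv ℝ P.symm z d) = 0 := by
      have h7 := (hk'.comp z hP).unique hkz
      have h8 := congrArg (fun T : F →L[ℝ] ℝ => T d) h7
      simpa [hℓ0] using h8
    have h9 := ((hl'.comp z hP).comp_hasDerivAt s hline)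
    have h10 : ((fderiv ℝ l (P.symm z)).comp (fderiv ℝ P.symm z)) d = 0 := h4 _ hkd
    rw [h10] at h9
    exact h9.hasDerivWithinAt
  have hc := constant_of_derivWithin_zero
    (f := fun s : ℝ => l (P.symm (Φ y + s • d))) (a := 0) (b := 1)
    (fun s hs => (hconst s hs).differentiableWithinAt)
    (fun s hs => (hconst s (Ico_subset_Icc_self hs)).derivWithin
      (uniqueDiffOn_Icc (by norm_num) s (Ico_subset_Icc_self hs))) 1 (by simp)
  have h11 : Φ y + (1 : ℝ) • d = σ (k y) := by rw [hd, one_smul]; abel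
  have h12 : P.symm (Φ y) = y := P.left_inv hys
  simp only [h11, zero_smul, add_zero, h12] at hc
  exact hc.symm

/-! ### Differential equations and brackets -/

/-- Local solvability of a non-autonomous ordinary differential equation with a continuously
differentiable right-hand side. -/
theorem exists_isOpen_contDiffOn_hasDerivAt {V : Type*} [NormedAddCommGroup V] [NormedSpace ℝ V]
    [CompleteSpace V] {G : ℝ × V → V} {t₀ : ℝ} {y₀ : V} (hG : ContDiffAt ℝ 1 G (t₀, y₀)) :
    ∃ (y : ℝ → V) (s : Set ℝ), IsOpen s ∧ t₀ ∈ s ∧ y t₀ = y₀ ∧ ContDiffOn ℝ 2 y s ∧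
      ∀ t ∈ s, HasDerivAt y (G (t, y t)) t := by
  -- The equation is made autonomous by adjoining time to the unknowns.
  have hA : ContDiffAt ℝ 1 (fun z : ℝ × V => ((1 : ℝ), G z)) (t₀, y₀) := contDiffAt_const.prodMk hG
  obtain ⟨γ, hγ0, ε, hε, hγ⟩ :=
    hA.exists_forall_mem_closedBall_exists_eq_forall_mem_Ioo_hasDerivAt₀ t₀
  set I := Ioo (t₀ - ε) (t₀ + ε) with hI
  have ht₀ : t₀ ∈ I := ⟨by linarith, by linarith⟩
  have h1 : ∀ t ∈ I, HasDerivAt (fun t => (γ t).1) 1 t := fun t ht => (hγ t ht).fst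
  have h2 : ∀ t ∈ I, HasDerivAt (fun t => (γ t).2) (G (γ t)) t := fun t ht => (hγ t ht).snd
  have hfst : ∀ t ∈ I, (γ t).1 = t := by
    intro t ht
    have := isOpen_Ioo.is_const_of_deriv_eq_zero (𝕜 := ℝ) (f := fun t => (γ t).1 - t)
      isPreconnected_Ioo
      (fun t ht => ((h1 t ht).sub (hasDerivAt_id t)).differentiableAt.differentiableWithinAt)
      (fun t ht => ((h1 t ht).sub (hasDerivAt_id t)).deriv.trans (sub_self 1)) ht ht₀
    simp [hγ0] at this
    linarith
  have hγe : ∀ t ∈ I, γ t = (t, (γ t).2) := fun t ht => Prod.ext (hfst t ht) rfl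
  have hcont : ContinuousAt γ t₀ := (hγ t₀ ht₀).continuousAt
  have hev : ∀ᶠ t in 𝓝 t₀, t ∈ I ∧ ContDiffAt ℝ 1 G (γ t) := by
    have hG' : ∀ᶠ z in 𝓝 (γ t₀), ContDiffAt ℝ 1 G z := by
      rw [hγ0]
      exact hG.eventually (by simp)
    filter_upwards [isOpen_Ioo.mem_nhds ht₀, hcont.eventually hG'] with t h h'
    exact ⟨h, h'⟩
  obtain ⟨s, hs, hso, hst⟩ := eventually_nhds_iff.1 hev
  have hy : ∀ t ∈ s, HasDerivAt (fun t => (γ t).2) (G (t, (γ t).2)) t := fun t ht => by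
    have := h2 t (hs t ht).1
    rwa [hγe t (hs t ht).1] at this
  have hdiff : DifferentiableOn ℝ (fun t => (γ t).2) s := fun t ht =>
    (hy t ht).differentiableAt.differentiableWithinAt
  have hpair : ∀ {m : WithTop ℕ∞}, m ≤ 1 → ContDiffOn ℝ m (fun t => (γ t).2) s →
      ContDiffOn ℝ m (deriv fun t => (γ t).2) s := by
    intro m hm h t ht
    have h3 : ContDiffWithinAt ℝ m (fun t => G (t, (γ t).2)) s t := by
      have h4 : ContDiffAt ℝ m G (t, (γ t).2) := by
        have := (hs t ht).2.of_le hm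
        rwa [hγe t (hs t ht).1] at this
      exact h4.comp_contDiffWithinAt t (contDiffWithinAt_id.prodMk (h t ht))
    exact h3.congr (fun t ht => (hy t ht).deriv) (hy t ht).deriv
  have hc1 : ContDiffOn ℝ 1 (fun t => (γ t).2) s := by
    have := (contDiffOn_succ_iff_deriv_of_isOpen (n := 0) hso).2
      ⟨hdiff, by simp, hpair (by simp) (contDiffOn_zero.2 hdiff.continuousOn)⟩
    simpa using this
  have hc2 : ContDiffOn ℝ 2 (fun t => (γ t).2) s := by
    have := (contDiffOn_succ_iff_deriv_of_isOpen (n := 1) hso).2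
      ⟨hdiff, by simp, hpair le_rfl hc1⟩
    rwa [one_add_one_eq_two] at this
  exact ⟨fun t => (γ t).2, s, hso, hst, by simp [hγ0], hc2, hy⟩

/-- The derivative of a function `D` vanishes on the bracket of two vector fields `X`, `Y` if `D` is
constant along `X` and its derivative along `Y` is a function of `D`. -/
theorem fderiv_bracket_eq_zero {F : Type*} [NormedAddCommGroup F] [NormedSpace ℝ F]
    {D : F → ℝ} {X Y : F → F} {X' Y' : F →L[ℝ] F} {η : ℝ → ℝ} {w : F} (hD : ContDiffAt ℝ 2 D w)
    (hX : HasFDerivAt X X' w) (hY : HasFDerivAt Y Y' w) (hη : DifferentiableAt ℝ η (D w))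
    (h1 : ∀ᶠ y in 𝓝 w, fderiv ℝ D y (X y) = 0)
    (h2 : ∀ᶠ y in 𝓝 w, fderiv ℝ D y (Y y) = η (D y)) :
    fderiv ℝ D w (Y' (X w) - X' (Y w)) = 0 := by
  have hDD : HasFDerivAt (fderiv ℝ D) (fderiv ℝ (fderiv ℝ D) w) w :=
    ((hD.fderiv_right (m := 1) (by norm_num)).differentiableAt (by simp)).hasFDerivAt
  have hD1 : HasFDerivAt D (fderiv ℝ D w) w := (hD.differentiableAt (by simp)).hasFDerivAt
  have e1 := (hDD.clm_apply hX).unique ((hasFDerivAt_const (0 : ℝ) w).congr_of_eventuallyEq h1)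
  have e2 := (hDD.clm_apply hY).unique
    ((hη.hasDerivAt.comp_hasFDerivAt w hD1).congr_of_eventuallyEq h2)
  have f1 := congrArg (fun T : F →L[ℝ] ℝ => T (Y w)) e1
  have f2 := congrArg (fun T : F →L[ℝ] ℝ => T (X w)) e2
  have hs := hD.isSymmSndFDerivAt (by simp) (X w) (Y w)
  simp [h1.self_of_nhds] at f1 f2
  rw [map_sub]
  linarith

/-! ### The characteristic fields and the invariants `K₁`, `L₁` -/

/-- The vector field `∂_v + 𝒟 ∂_{v₁}` at a point where `𝒟 = d`. -/
def fieldX (d : ℝ) : Pair × Pair := ((0, 1), (0, d))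

/-- The vector field `(u + v) ∂_u + (u₁ + v₁) E ∂_{u₁} + (1 + 1/α) (v₁ E - v 𝒟) ∂_{v₁}`, with
`E = 𝒟^(1/α)`, at a point where `𝒟 = d`. -/
def fieldY (α : ℝ) (w : Pair × Pair) (d : ℝ) : Pair × Pair :=
  ((w.1.1 + w.1.2, 0),
    ((w.2.1 + w.2.2) * d ^ (1 / α), (1 + 1 / α) * (w.2.2 * d ^ (1 / α) - w.1.2 * d)))

/-- The bracket of `fieldX` and `fieldY` along a solution of `SolvesPDE`:
`∂_u + 𝒟 E ∂_{u₁} + 𝒟 (E - 1) / α ∂_{v₁}`, with `E = 𝒟^(1/α)`, at a point where `𝒟 = d`. -/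
def fieldZ (α d : ℝ) : Pair × Pair := ((1, 0), (d * d ^ (1 / α), 1 / α * d * (d ^ (1 / α) - 1)))

/-- At `w`, the function `D` solves the quasilinear system `X D = 0`, `Y D = D (D^(1/α) - 1)` to
which the invariance of `J₁` reduces. -/
structure SolvesPDE (α : ℝ) (D : Pair × Pair → ℝ) (w : Pair × Pair) : Prop where
  eq_X : fderiv ℝ D w (fieldX (D w)) = 0
  eq_Y : fderiv ℝ D w (fieldY α w (D w)) = D w * (D w ^ (1 / α) - 1)

/-- The pair `(K₁, L₁)` as a function of the five variables `u, v, u₁, v₁, 𝒟₁`. -/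
def invariants (α : ℝ) (z : (Pair × Pair) × ℝ) : ℝ × ℝ := (K₁ α z.1 z.2, L₁ α z.1 z.2)

theorem hasDerivAt_rpow_inv {α : ℝ} {d : ℝ → ℝ} {d' t : ℝ} (hd : HasDerivAt d d' t)
    (hpos : 0 < d t) :
    HasDerivAt (fun t => d t ^ (1 / α)) (d t ^ (1 / α) * d' / (α * d t)) t := by
  convert! hd.rpow_const (p := 1 / α) (Or.inl hpos.ne') using 1
  rw [Real.rpow_sub hpos, Real.rpow_one]
  field_simp

theorem hasDerivAt_abs_rpow {α : ℝ} {e : ℝ → ℝ} {e' t : ℝ} (he : HasDerivAt e e' t)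
    (h0 : e t ≠ 0) :
    HasDerivAt (fun t => |e t| ^ α) (|e t| ^ α * (α * e' / e t)) t := by
  have h1 : HasDerivAt (fun t => |e t|) (SignType.sign (e t) * e') t :=
    (hasDerivAt_abs h0).comp t he
  convert! h1.rpow_const (p := α) (Or.inl (abs_ne_zero.2 h0)) using 1
  rw [Real.rpow_sub (abs_pos.2 h0), Real.rpow_one]
  rcases h0.lt_or_gt with h | h
  · simp [abs_of_neg h, sign_neg h]
    field_simp
  · simp [abs_of_pos h, sign_pos h]
    field_simp

theorem rpow_one_add_inv {α d : ℝ} (hd : 0 < d) : d ^ (1 + 1 / α) = d * d ^ (1 / α) := by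
  rw [Real.rpow_add hd, Real.rpow_one]

theorem rpow_inv_ne_one {α d : ℝ} (hα : α ≠ 0) (hd : 0 < d) (h1 : d ≠ 1) : d ^ (1 / α) ≠ 1 := by
  intro h
  apply h1
  have := congrArg (fun y => y ^ α) h
  simpa [← Real.rpow_mul hd.le, hα] using this

/-- The derivative of the numerator of `K₁` along a curve, in terms of `E = 𝒟^(1/α)`. -/
def derivQ (α u₁ v v₁ d E v' u₁' v₁' d' E' : ℝ) : ℝ :=
  α * v₁' * E + α * v₁ * E' - α * v' * (d * E) - α * v * (d' * E + d * E') + (1 - E) * u₁' - E' * u₁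

theorem hasDerivAt_invariants {α : ℝ} (hα : α ≠ 0) {u v u₁ v₁ d : ℝ → ℝ} {u' v' u₁' v₁' d' t : ℝ}
    (hu : HasDerivAt u u' t) (hv : HasDerivAt v v' t) (hu₁ : HasDerivAt u₁ u₁' t)
    (hv₁ : HasDerivAt v₁ v₁' t) (hd : HasDerivAt d d' t) (hpos : 0 < d t) (h1 : d t ≠ 1)
    {E E' R Q Q' P : ℝ} (hE : E = d t ^ (1 / α)) (hE' : E' = E * d' / (α * d t))
    (hR : R = |E - 1| ^ α)
    (hQ : Q = α * v₁ t * E - α * v t * (d t * E) + (1 - E) * u₁ t)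
    (hQ' : Q' = derivQ α (u₁ t) (v t) (v₁ t) (d t) E v' u₁' v₁' d' E')
    (hP : P = u₁ t - d t * E * u t) :
    HasDerivAt (fun t => invariants α (((u t, v t), (u₁ t, v₁ t)), d t))
      ((Q' - (α + 1) * Q * E' / (E - 1)) / ((E - 1) * R),
        ((u₁' - (d' * E + d t * E') * u t - d t * E * u') - P * (E' / E + α * E' / (E - 1)))
            / (E * R) +
          (Q' - Q * (E' / E + (α + 1) * E' / (E - 1))) / (E * ((E - 1) * R))) t := by
  have hE0 : E ≠ 0 := by rw [hE]; positivity
  have hE1 : E - 1 ≠ 0 := by rw [hE]; exact sub_ne_zero.2 (rpow_inv_ne_one hα hpos h1)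
  have hR0 : R ≠ 0 := by
    rw [hR]
    exact (Real.rpow_pos_of_pos (abs_pos.2 hE1) _).ne'
  have dE : HasDerivAt (fun t => d t ^ (1 / α)) E' t := by
    rw [hE', hE]
    exact hasDerivAt_rpow_inv hd hpos
  have dR : HasDerivAt (fun t => |d t ^ (1 / α) - 1| ^ α) (R * (α * E' / (E - 1))) t := by
    rw [hR, hE]
    rw [hE] at hE1
    exact hasDerivAt_abs_rpow (dE.sub_const 1) hE1
  have dF : HasDerivAt (fun t => d t ^ (1 + 1 / α)) (d' * E + d t * E') t := by
    have h2 : (fun t => d t ^ (1 + 1 / α)) =ᶠ[𝓝 t] fun t => d t * d t ^ (1 / α) := by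
      filter_upwards [hd.continuousAt.eventually (lt_mem_nhds hpos)] with s hs
      exact rpow_one_add_inv hs
    rw [hE]
    exact (hd.mul dE).congr_of_eventuallyEq h2
  have dQ := (((hv₁.const_mul α).mul dE).sub ((hv.const_mul α).mul dF)).add
    ((dE.const_sub 1).mul hu₁)
  have dS := (dE.sub_const 1).mul dR
  have hS0 : (d t ^ (1 / α) - 1) * |d t ^ (1 / α) - 1| ^ α ≠ 0 := by
    rw [← hE, ← hR]
    exact mul_ne_zero hE1 hR0
  have hE0' : d t ^ (1 / α) ≠ 0 := hE ▸ hE0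
  have hR0' : |d t ^ (1 / α) - 1| ^ α ≠ 0 := by rw [← hE, ← hR]; exact hR0
  have dK := dQ.div dS hS0
  have dL := ((hu₁.sub (dF.mul hu)).div (dE.mul dR) (mul_ne_zero hE0' hR0')).add
    (dQ.div (dE.mul dS) (mul_ne_zero hE0' hS0))
  convert! dK.prodMk dL using 1
  simp only [Pi.mul_apply, Pi.sub_apply, Pi.add_apply, ← hE, ← hR, rpow_one_add_inv hpos, hQ, hQ',
    hP, derivQ]
  refine Prod.ext ?_ ?_
  · simp only
    field_simp
    ring
  · simp only
    field_simp
    ring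

theorem contDiffAt_invariants {α : ℝ} (hα : α ≠ 0) {z : (Pair × Pair) × ℝ} (hpos : 0 < z.2)
    (h1 : z.2 ≠ 1) : ContDiffAt ℝ ∞ (invariants α) z := by
  have hE1 : z.2 ^ (1 / α) - 1 ≠ 0 := sub_ne_zero.2 (rpow_inv_ne_one hα hpos h1)
  have hR : 0 < |z.2 ^ (1 / α) - 1| ^ α := Real.rpow_pos_of_pos (abs_pos.2 hE1) _
  have dd : ContDiffAt ℝ ∞ (fun z : (Pair × Pair) × ℝ => z.2) z := contDiffAt_snd
  have dE : ContDiffAt ℝ ∞ (fun z : (Pair × Pair) × ℝ => z.2 ^ (1 / α)) z :=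
    dd.rpow_const_of_ne hpos.ne'
  have dF : ContDiffAt ℝ ∞ (fun z : (Pair × Pair) × ℝ => z.2 ^ (1 + 1 / α)) z :=
    dd.rpow_const_of_ne hpos.ne'
  have dR : ContDiffAt ℝ ∞ (fun z : (Pair × Pair) × ℝ => |z.2 ^ (1 / α) - 1| ^ α) z :=
    (ContDiffAt.comp z (f := fun z : (Pair × Pair) × ℝ => z.2 ^ (1 / α) - 1) (contDiffAt_abs hE1)
      (dE.sub contDiffAt_const)).rpow_const_of_ne (abs_ne_zero.2 hE1)
  have du : ContDiffAt ℝ ∞ (fun z : (Pair × Pair) × ℝ => z.1.1.1) z := by fun_prop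
  have dv : ContDiffAt ℝ ∞ (fun z : (Pair × Pair) × ℝ => z.1.1.2) z := by fun_prop
  have du₁ : ContDiffAt ℝ ∞ (fun z : (Pair × Pair) × ℝ => z.1.2.1) z := by fun_prop
  have dv₁ : ContDiffAt ℝ ∞ (fun z : (Pair × Pair) × ℝ => z.1.2.2) z := by fun_prop
  have dQ := (((contDiffAt_const (c := α)).mul dv₁).mul dE).sub
    (((contDiffAt_const (c := α)).mul dv).mul dF) |>.add
    (((contDiffAt_const (c := (1 : ℝ))).sub dE).mul du₁)
  have dS := (dE.sub (contDiffAt_const (c := (1 : ℝ)))).mul dR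
  have hS0 : (z.2 ^ (1 / α) - 1) * |z.2 ^ (1 / α) - 1| ^ α ≠ 0 := mul_ne_zero hE1 hR.ne'
  have hE0 : z.2 ^ (1 / α) ≠ 0 := by positivity
  exact (dQ.div dS hS0).prodMk
    (((du₁.sub (dF.mul du)).div (dE.mul dR) (mul_ne_zero hE0 hR.ne')).add
      (dQ.div (dE.mul dS) (mul_ne_zero hE0 hS0)))

theorem fderiv_invariants_apply {α : ℝ} (hα : α ≠ 0) {u v u₁ v₁ d : ℝ} (u' v' u₁' v₁' d' : ℝ)
    (hpos : 0 < d) (h1 : d ≠ 1)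
    {E E' R Q Q' P : ℝ} (hE : E = d ^ (1 / α)) (hE' : E' = E * d' / (α * d))
    (hR : R = |E - 1| ^ α)
    (hQ : Q = α * v₁ * E - α * v * (d * E) + (1 - E) * u₁)
    (hQ' : Q' = derivQ α u₁ v v₁ d E v' u₁' v₁' d' E')
    (hP : P = u₁ - d * E * u) :
    fderiv ℝ (invariants α) (((u, v), (u₁, v₁)), d) (((u', v'), (u₁', v₁')), d') =
      ((Q' - (α + 1) * Q * E' / (E - 1)) / ((E - 1) * R),
        ((u₁' - (d' * E + d * E') * u - d * E * u') - P * (E' / E + α * E' / (E - 1)))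
            / (E * R) +
          (Q' - Q * (E' / E + (α + 1) * E' / (E - 1))) / (E * ((E - 1) * R))) := by
  have line : ∀ a b : ℝ, HasDerivAt (fun t => a + t * b) b 0 := fun a b => by
    simpa using ((hasDerivAt_id (0 : ℝ)).mul_const b).const_add a
  have hz : HasFDerivAt (invariants α) (fderiv ℝ (invariants α) (((u, v), (u₁, v₁)), d))
      (((u + 0 * u', v + 0 * v'), (u₁ + 0 * u₁', v₁ + 0 * v₁')), d + 0 * d') := by
    simpa using ((contDiffAt_invariants hα (z := (((u, v), (u₁, v₁)), d)) hpos h1).differentiableAt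
      (by simp)).hasFDerivAt
  have h2 := hz.comp_hasDerivAt (0 : ℝ) ((((line u u').prodMk (line v v')).prodMk
    ((line u₁ u₁').prodMk (line v₁ v₁'))).prodMk (line d d'))
  have h3 := hasDerivAt_invariants hα (line u u') (line v v') (line u₁ u₁') (line v₁ v₁')
    (line d d') (by simpa using hpos) (by simpa using h1) (E := E) (E' := E') (R := R) (Q := Q)
    (Q' := Q') (P := P) (by simpa using hE) (by simpa using hE') (by simpa using hR)
    (by simpa using hQ) (by simpa using hQ') (by simpa using hP)
  simpa using h2.unique h3

section Annihilation

variable {α : ℝ} {w : Pair × Pair} {d : ℝ}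

theorem fderiv_invariants_fieldX (hα : α ≠ 0) (hpos : 0 < d) (h1 : d ≠ 1) :
    fderiv ℝ (invariants α) (w, d) (fieldX d, 0) = 0 := by
  obtain ⟨⟨u, v⟩, ⟨u₁, v₁⟩⟩ := w
  rw [fieldX, fderiv_invariants_apply hα _ _ _ _ _ hpos h1 rfl rfl rfl rfl rfl rfl]
  simp only [derivQ]
  ext <;> simp <;> ring_nf <;> simp

theorem fderiv_invariants_fieldY (hα : α ≠ 0) (hpos : 0 < d) (h1 : d ≠ 1) :
    fderiv ℝ (invariants α) (w, d) (fieldY α w d, d * (d ^ (1 / α) - 1)) = 0 := by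
  obtain ⟨⟨u, v⟩, ⟨u₁, v₁⟩⟩ := w
  have hE1 : d ^ (1 / α) - 1 ≠ 0 := sub_ne_zero.2 (rpow_inv_ne_one hα hpos h1)
  have hR : |d ^ (1 / α) - 1| ^ α ≠ 0 := (Real.rpow_pos_of_pos (abs_pos.2 hE1) _).ne'
  have hE0 : d ^ (1 / α) ≠ 0 := by positivity
  rw [fieldY, fderiv_invariants_apply hα _ _ _ _ _ hpos h1 rfl rfl rfl rfl rfl rfl]
  simp only [derivQ]
  generalize |d ^ (1 / α) - 1| ^ α = R at *
  generalize d ^ (1 / α) = E at *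
  refine Prod.ext ?_ ?_
  · simp only [Prod.fst_zero]
    field_simp
    ring
  · simp only [Prod.snd_zero]
    field_simp
    ring

theorem fderiv_invariants_fieldZ (hα : α ≠ 0) (hpos : 0 < d) (h1 : d ≠ 1) :
    fderiv ℝ (invariants α) (w, d) (fieldZ α d, 0) = 0 := by
  obtain ⟨⟨u, v⟩, ⟨u₁, v₁⟩⟩ := w
  have hE1 : d ^ (1 / α) - 1 ≠ 0 := sub_ne_zero.2 (rpow_inv_ne_one hα hpos h1)
  have hR : |d ^ (1 / α) - 1| ^ α ≠ 0 := (Real.rpow_pos_of_pos (abs_pos.2 hE1) _).ne'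
  have hE0 : d ^ (1 / α) ≠ 0 := by positivity
  rw [fieldZ, fderiv_invariants_apply hα _ _ _ _ _ hpos h1 rfl rfl rfl rfl rfl rfl]
  simp only [derivQ]
  generalize |d ^ (1 / α) - 1| ^ α = R at *
  generalize d ^ (1 / α) = E at *
  refine Prod.ext ?_ ?_
  · simp only [Prod.fst_zero]
    field_simp
    ring
  · simp only [Prod.snd_zero]
    field_simp
    ring

theorem fderiv_invariants_u (hα : α ≠ 0) (hpos : 0 < d) (h1 : d ≠ 1) :
    ∃ c ≠ 0, fderiv ℝ (invariants α) (w, d) (((1, 0), (0, 0)), 0) = (0, c) := by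
  obtain ⟨⟨u, v⟩, ⟨u₁, v₁⟩⟩ := w
  have hE1 : d ^ (1 / α) - 1 ≠ 0 := sub_ne_zero.2 (rpow_inv_ne_one hα hpos h1)
  have hR : |d ^ (1 / α) - 1| ^ α ≠ 0 := (Real.rpow_pos_of_pos (abs_pos.2 hE1) _).ne'
  have hE0 : d ^ (1 / α) ≠ 0 := by positivity
  rw [fderiv_invariants_apply hα _ _ _ _ _ hpos h1 rfl rfl rfl rfl rfl rfl]
  refine ⟨-(d * d ^ (1 / α)) / (d ^ (1 / α) * |d ^ (1 / α) - 1| ^ α), ?_, ?_⟩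
  · exact div_ne_zero (neg_ne_zero.2 (mul_ne_zero hpos.ne' hE0)) (mul_ne_zero hE0 hR)
  · simp [derivQ]

theorem fderiv_invariants_v (hα : α ≠ 0) (hpos : 0 < d) (h1 : d ≠ 1) :
    (fderiv ℝ (invariants α) (w, d) (((0, 1), (0, 0)), 0)).1 ≠ 0 := by
  obtain ⟨⟨u, v⟩, ⟨u₁, v₁⟩⟩ := w
  have hE1 : d ^ (1 / α) - 1 ≠ 0 := sub_ne_zero.2 (rpow_inv_ne_one hα hpos h1)
  have hR : |d ^ (1 / α) - 1| ^ α ≠ 0 := (Real.rpow_pos_of_pos (abs_pos.2 hE1) _).ne'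
  have hE0 : d ^ (1 / α) ≠ 0 := by positivity
  rw [fderiv_invariants_apply hα _ _ _ _ _ hpos h1 rfl rfl rfl rfl rfl rfl]
  simp [derivQ]
  exact ⟨⟨hα, hpos.ne', by simpa using hE0⟩, by simpa using hE1, by simpa using hR⟩

end Annihilation

/-! ### The quasilinear system and implicit equations -/

section Implicit

variable {α : ℝ} {D : Pair × Pair → ℝ} {w : Pair × Pair} {H : ℝ × ℝ → ℝ}

theorem hasFDerivAt_invariants_graph (hα : α ≠ 0) (hD : DifferentiableAt ℝ D w) (hpos : 0 < D w)
    (h1 : D w ≠ 1) :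
    HasFDerivAt (fun y => invariants α (y, D y))
      ((fderiv ℝ (invariants α) (w, D w)).comp
        ((ContinuousLinearMap.id ℝ (Pair × Pair)).prod (fderiv ℝ D w))) w :=
  HasFDerivAt.comp w (f := fun y => (y, D y))
    ((contDiffAt_invariants hα (z := (w, D w)) hpos h1).differentiableAt (by simp)).hasFDerivAt
    ((hasFDerivAt_id w).prodMk hD.hasFDerivAt)

theorem deriv_comp_invariants (hα : α ≠ 0) (hH : Differentiable ℝ H) {d : ℝ} (hpos : 0 < d)
    (h1 : d ≠ 1) :
    deriv (fun d => H (K₁ α w d, L₁ α w d)) d =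
      fderiv ℝ H (invariants α (w, d)) (fderiv ℝ (invariants α) (w, d) (0, 1)) := by
  have h2 : HasFDerivAt (invariants α) (fderiv ℝ (invariants α) (w, d)) (w, d) :=
    ((contDiffAt_invariants hα (z := (w, d)) hpos h1).differentiableAt (by simp)).hasFDerivAt
  have h3 : HasDerivAt (fun d : ℝ => (w, d)) (0, 1) d :=
    (hasDerivAt_const d w).prodMk (hasDerivAt_id d)
  have h4 := (hH (invariants α (w, d))).hasFDerivAt.comp_hasDerivAt d (h2.comp_hasDerivAt d h3)
  exact h4.deriv

/-- Differentiating `H (K₁, L₁) = 0` along the graph of `D`. -/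
theorem fderiv_comp_invariants_graph (hα : α ≠ 0) (hD : DifferentiableAt ℝ D w) (hpos : 0 < D w)
    (h1 : D w ≠ 1) (hH : Differentiable ℝ H)
    (h0 : ∀ᶠ y in 𝓝 w, H (invariants α (y, D y)) = 0) (ξ : Pair × Pair) :
    fderiv ℝ H (invariants α (w, D w))
      (fderiv ℝ (invariants α) (w, D w) (ξ, fderiv ℝ D w ξ)) = 0 := by
  have h2 := (hH (invariants α (w, D w))).hasFDerivAt.comp w
    (hasFDerivAt_invariants_graph hα hD hpos h1)
  have h3 := h2.unique ((hasFDerivAt_const (0 : ℝ) w).congr_of_eventuallyEq h0)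
  simpa using congrArg (fun T : Pair × Pair →L[ℝ] ℝ => T ξ) h3

/-- A function given implicitly by `H (K₁, L₁) = 0` solves the quasilinear system: `K₁` and `L₁` are
invariants of the characteristic fields `X` and `Y + 𝒟 (E - 1) ∂_𝒟`. -/
theorem IsImplicitNear.solvesPDE (h : IsImplicitNear α H D w) (hα : α ≠ 0)
    (hD : DifferentiableAt ℝ D w) (hpos : 0 < D w) (h1 : D w ≠ 1) (hH : Differentiable ℝ H) :
    SolvesPDE α D w := by
  obtain ⟨h0, hne⟩ := h
  rw [deriv_comp_invariants hα hH hpos h1] at hne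
  set T := (fderiv ℝ H (invariants α (w, D w))).comp (fderiv ℝ (invariants α) (w, D w)) with hT
  have key : ∀ ξ η, fderiv ℝ (invariants α) (w, D w) (ξ, η) = 0 → fderiv ℝ D w ξ = η := by
    intro ξ η hξ
    have h2 : T (ξ, fderiv ℝ D w ξ) = 0 := fderiv_comp_invariants_graph hα hD hpos h1 hH h0 ξ
    have h3 : T (ξ, η) = 0 := by simp [hT, hξ]
    have h4 : ((ξ, fderiv ℝ D w ξ) : (Pair × Pair) × ℝ) =
        (ξ, η) + (fderiv ℝ D w ξ - η) • ((0 : Pair × Pair), (1 : ℝ)) := by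
      simp
    rw [h4, map_add, h3, map_smul, zero_add, smul_eq_mul] at h2
    exact sub_eq_zero.1 ((mul_eq_zero.1 h2).resolve_right hne)
  exact ⟨key _ _ (fderiv_invariants_fieldX hα hpos h1),
    key _ _ (fderiv_invariants_fieldY hα hpos h1)⟩

theorem solvesPDE_of_eventually_eq_one (h : ∀ᶠ y in 𝓝 w, D y = 1) : SolvesPDE α D w := by
  have h2 : fderiv ℝ D w = 0 := by
    have h3 : HasFDerivAt D (0 : Pair × Pair →L[ℝ] ℝ) w :=
      (hasFDerivAt_const (1 : ℝ) w).congr_of_eventuallyEq h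
    exact h3.fderiv
  exact ⟨by simp [h2], by simp [h2, h.self_of_nhds]⟩

theorem continuousAt_fieldY (hD : ContinuousAt D w) (hpos : 0 < D w) :
    ContinuousAt (fun y => fieldY α y (D y)) w := by
  have hE : ContinuousAt (fun y => D y ^ (1 / α)) w := hD.rpow_const (Or.inl hpos.ne')
  have c : ∀ {g : Pair × Pair → ℝ}, Continuous g → ContinuousAt g w := fun h => h.continuousAt
  exact ((c (by fun_prop)).prodMk continuousAt_const).prodMk
    (((c (by fun_prop)).mul hE).prodMk
      (continuousAt_const.mul (((c (by fun_prop)).mul hE).sub ((c (by fun_prop)).mul hD))))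

/-- The set of points where the quasilinear system holds is closed. -/
theorem solvesPDE_of_frequently (hD : ContDiffAt ℝ 1 D w) (hpos : 0 < D w)
    (h : ∃ᶠ y in 𝓝 w, SolvesPDE α D y) : SolvesPDE α D w := by
  have hc : ContinuousAt (fderiv ℝ D) w := (hD.fderiv_right (m := 0) (by simp)).continuousAt
  have hX : ContinuousAt (fun y => fieldX (D y)) w :=
    continuousAt_const.prodMk (continuousAt_const.prodMk hD.continuousAt)
  have hE : ContinuousAt (fun y => D y ^ (1 / α)) w :=
    hD.continuousAt.rpow_const (Or.inl hpos.ne')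
  constructor
  · have := hc.clm_apply hX
    by_contra hne
    exact h ((this.eventually_ne hne).mono fun y hy hy' => hy hy'.eq_X)
  · have := (hc.clm_apply (continuousAt_fieldY (α := α) hD.continuousAt hpos)).sub
      (hD.continuousAt.mul (hE.sub (continuousAt_const (y := (1 : ℝ)))))
    by_contra hne
    exact h ((this.eventually_ne (sub_ne_zero.2 hne)).mono
      fun y hy hy' => hy (sub_eq_zero.2 hy'.eq_Y))

/-- The quasilinear system at every point, from its alternatives: at points where `D = 1` it follows
from the points with `D ≠ 1` by continuity, unless `D = 1` nearby. -/
theorem solvesPDE_of_eq_one_or_implicit (hα : α ≠ 0) {S : Set (Pair × Pair)} (hS : IsOpen S)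
    (hD : ContDiffOn ℝ ∞ D S) (hpos : ∀ w ∈ S, 0 < D w)
    (h : ∀ w ∈ S, D w = 1 ∨ ∃ H : ℝ × ℝ → ℝ, ContDiff ℝ ∞ H ∧ IsImplicitNear α H D w) :
    ∀ w ∈ S, SolvesPDE α D w := by
  have hdiff : ∀ w ∈ S, ContDiffAt ℝ ∞ D w := fun w hw => hD.contDiffAt (hS.mem_nhds hw)
  have hne : ∀ w ∈ S, D w ≠ 1 → SolvesPDE α D w := by
    intro w hw h1
    obtain ⟨H, hH, hi⟩ := (h w hw).resolve_left h1
    exact hi.solvesPDE hα ((hdiff w hw).differentiableAt (by simp)) (hpos w hw) h1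
      (hH.differentiable (by simp))
  intro w hw
  by_cases h1 : ∀ᶠ y in 𝓝 w, D y = 1
  · exact solvesPDE_of_eventually_eq_one h1
  · refine solvesPDE_of_frequently ((hdiff w hw).of_le (by exact_mod_cast le_top)) (hpos w hw) ?_
    exact ((not_eventually.1 h1).and_eventually (hS.mem_nhds hw)).mono
      fun y hy => hne y hy.2 hy.1

/-- Near a point, a solution of the quasilinear system is also constant along the bracket `Z` of its
two characteristic fields. -/
theorem fderiv_fieldZ_eq_zero (hα : α ≠ 0) (hD : ContDiffAt ℝ 2 D w) (hpos : 0 < D w)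
    (h : ∀ᶠ y in 𝓝 w, SolvesPDE α D y) : fderiv ℝ D w (fieldZ α (D w)) = 0 := by
  have hd : HasFDerivAt D (fderiv ℝ D w) w := (hD.differentiableAt (by simp)).hasFDerivAt
  have hE := hd.rpow_const (p := 1 / α) (Or.inl hpos.ne')
  have du := (hasFDerivAt_fst (𝕜 := ℝ) (p := w)).fst
  have dv := (hasFDerivAt_fst (𝕜 := ℝ) (p := w)).snd
  have du₁ := (hasFDerivAt_snd (𝕜 := ℝ) (p := w)).fst
  have dv₁ := (hasFDerivAt_snd (𝕜 := ℝ) (p := w)).snd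
  have hX : HasFDerivAt (fun y => fieldX (D y)) _ w :=
    (hasFDerivAt_const ((0, 1) : Pair) w).prodMk ((hasFDerivAt_const (0 : ℝ) w).prodMk hd)
  have hY : HasFDerivAt (fun y => fieldY α y (D y)) _ w :=
    ((du.add dv).prodMk (hasFDerivAt_const (0 : ℝ) w)).prodMk
      (((du₁.add dv₁).mul hE).prodMk (((dv₁.mul hE).sub (dv.mul hd)).const_mul (1 + 1 / α)))
  have hη : DifferentiableAt ℝ (fun d : ℝ => d * (d ^ (1 / α) - 1)) (D w) :=
    differentiableAt_id.mul
      ((Real.differentiableAt_rpow_const_of_ne (1 / α) hpos.ne').sub (differentiableAt_const 1))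
  have key := fderiv_bracket_eq_zero hD hX hY hη (h.mono fun y hy => hy.eq_X)
    (h.mono fun y hy => hy.eq_Y)
  have hx := h.self_of_nhds.eq_X
  have hy := h.self_of_nhds.eq_Y
  rw [← key]
  congr 1
  simp [hx, hy]
  simp only [fieldX, fieldZ, Prod.mk.injEq, zero_add, mul_one, mul_zero, true_and]
  constructor <;> (field_simp; try ring)

/-- Two functionals that vanish on `X`, `Y` and `Z` are proportional if these three vectors are
independent. -/
theorem apply_eq_zero_of_fields {a b : Pair × Pair →L[ℝ] ℝ} {d : ℝ} (ha : a ≠ 0)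
    (hY : fieldY α w d ≠ (w.1.1 + w.1.2) • fieldZ α d)
    (aX : a (fieldX d) = 0) (aY : a (fieldY α w d) = 0) (aZ : a (fieldZ α d) = 0)
    (bX : b (fieldX d) = 0) (bY : b (fieldY α w d) = 0) (bZ : b (fieldZ α d) = 0)
    {ξ : Pair × Pair} (hξ : a ξ = 0) : b ξ = 0 := by
  set τ := fieldY α w d - (w.1.1 + w.1.2) • fieldZ α d with hτ
  have hτ0 : τ ≠ 0 := sub_ne_zero.2 hY
  have hτ1 : τ.1 = 0 := by ext <;> simp [hτ, fieldY, fieldZ]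
  have red : ∀ (c : Pair × Pair →L[ℝ] ℝ), c (fieldX d) = 0 → c (fieldZ α d) = 0 → ∀ ξ,
      c ξ = c (0, (1, 0)) * (ξ - ξ.1.2 • fieldX d - ξ.1.1 • fieldZ α d).2.1 +
        c (0, (0, 1)) * (ξ - ξ.1.2 • fieldX d - ξ.1.1 • fieldZ α d).2.2 := by
    intro c cX cZ ξ
    have h1 : c ξ = c (ξ - ξ.1.2 • fieldX d - ξ.1.1 • fieldZ α d) := by simp [cX, cZ]
    rw [h1]
    set ζ := ξ - ξ.1.2 • fieldX d - ξ.1.1 • fieldZ α d with hζ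
    have h2 : ζ.1 = 0 := by ext <;> simp [hζ, fieldX, fieldZ]
    have h3 : ζ = ζ.2.1 • ((0 : Pair), ((1 : ℝ), (0 : ℝ))) +
        ζ.2.2 • ((0 : Pair), ((0 : ℝ), (1 : ℝ))) := by
      refine Prod.ext (by simp [h2]) ?_
      ext <;> simp
    conv_lhs => rw [h3]
    rw [map_add, map_smul, map_smul, smul_eq_mul, smul_eq_mul]
    ring
  have aτ : a τ = 0 := by simp [hτ, aY, aZ]
  have bτ : b τ = 0 := by simp [hτ, bY, bZ]
  rw [red a aX aZ] at aτ hξ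
  rw [red b bX bZ] at bτ ⊢
  simp only [hτ1, Prod.fst_zero, Prod.snd_zero, zero_smul, sub_zero] at aτ bτ
  set η := (ξ - ξ.1.2 • fieldX d - ξ.1.1 • fieldZ α d).2
  have ha' : a (0, (1, 0)) ≠ 0 ∨ a (0, (0, 1)) ≠ 0 := by
    by_contra! hcon
    apply ha
    refine ContinuousLinearMap.ext fun ζ => ?_
    rw [red a aX aZ, hcon.1, hcon.2]
    simp
  have hτ2 : τ.2.1 ≠ 0 ∨ τ.2.2 ≠ 0 := by
    by_contra! hcon
    exact hτ0 (Prod.ext hτ1 (Prod.ext hcon.1 hcon.2))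
  generalize a (0, (1, 0)) = a₁ at *
  generalize a (0, (0, 1)) = a₂ at *
  generalize b (0, (1, 0)) = b₁ at *
  generalize b (0, (0, 1)) = b₂ at *
  have hpar : η.1 * τ.2.2 = η.2 * τ.2.1 := by
    rcases ha' with h | h
    · apply mul_left_cancel₀ h
      linear_combination τ.2.2 * hξ - η.2 * aτ
    · apply mul_left_cancel₀ h
      linear_combination η.1 * aτ - τ.2.1 * hξ
  rcases hτ2 with h | h
  · apply mul_left_cancel₀ h
    linear_combination η.1 * bτ - b₂ * hpar
  · apply mul_left_cancel₀ h
    linear_combination η.2 * bτ + b₁ * hpar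

/-- A relation `H (K₁, L₁) = 0` with `dH ≠ 0` along the graph of `D` is nondegenerate in `𝒟₁`:
otherwise `dH` would annihilate the partial derivatives of `(K₁, L₁)` in `u` and `v`, which are
independent. -/
theorem isImplicitNear_of_fderiv_ne_zero (hα : α ≠ 0) (hD : DifferentiableAt ℝ D w) (hpos : 0 < D w)
    (h1 : D w ≠ 1) (hH : Differentiable ℝ H)
    (h0 : ∀ᶠ y in 𝓝 w, H (invariants α (y, D y)) = 0)
    (hne : fderiv ℝ H (invariants α (w, D w)) ≠ 0) : IsImplicitNear α H D w := by
  refine ⟨h0, fun hc => hne ?_⟩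
  rw [deriv_comp_invariants hα hH hpos h1] at hc
  have key : ∀ ξ, fderiv ℝ H (invariants α (w, D w))
      (fderiv ℝ (invariants α) (w, D w) (ξ, 0)) = 0 := by
    intro ξ
    have h2 := fderiv_comp_invariants_graph hα hD hpos h1 hH h0 ξ
    have h3 : ((ξ, fderiv ℝ D w ξ) : (Pair × Pair) × ℝ) =
        (ξ, 0) + fderiv ℝ D w ξ • ((0 : Pair × Pair), (1 : ℝ)) := by
      simp
    rwa [h3, map_add, map_smul, map_add, map_smul, hc, smul_zero, add_zero] at h2
  obtain ⟨c, hc0, hcu⟩ := fderiv_invariants_u (w := w) hα hpos h1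
  have hcv := fderiv_invariants_v (w := w) hα hpos h1
  have ku := key ((1, 0), (0, 0))
  have kv := key ((0, 1), (0, 0))
  rw [hcu] at ku
  set T := fderiv ℝ H (invariants α (w, D w))
  set q := fderiv ℝ (invariants α) (w, D w) (((0, 1), (0, 0)), 0)
  have split : ∀ q : ℝ × ℝ, T q = q.1 * T (1, 0) + q.2 * T (0, 1) := by
    intro q
    have : q = q.1 • ((1 : ℝ), (0 : ℝ)) + q.2 • ((0 : ℝ), (1 : ℝ)) := by ext <;> simp
    conv_lhs => rw [this]
    rw [map_add, map_smul, map_smul, smul_eq_mul, smul_eq_mul]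
  have t2 : T (0, 1) = 0 := by
    rw [split] at ku
    simpa [hc0] using ku
  have t1 : T (1, 0) = 0 := by
    rw [split, t2] at kv
    simpa [hcv] using kv
  ext1 <;> ext1 <;> simp [t1, t2]

theorem fderiv_ne_zero_of_hasDerivAt_line {F : Type*} [NormedAddCommGroup F] [NormedSpace ℝ F]
    {h : F → ℝ} {q v : F} (hh : DifferentiableAt ℝ h q)
    (hd : HasDerivAt (fun t : ℝ => h (q + t • v)) 1 0) : fderiv ℝ h q ≠ 0 := by
  intro h0
  have h2 : HasDerivAt (fun t : ℝ => q + t • v) v 0 := by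
    simpa using ((hasDerivAt_id (0 : ℝ)).smul_const v).const_add q
  have h3 := hh.hasFDerivAt.comp_hasDerivAt_of_eq (0 : ℝ) h2 (by simp)
  rw [h0] at h3
  exact zero_ne_one (h3.unique hd)

/-- Where it differs from `1`, a solution of the quasilinear system is given implicitly by an
equation `H (K₁, L₁) = 0`: along its graph the differentials of `K₁` and `L₁` vanish on `X`, `Y`,
`Z`, hence are proportional, and they do not both vanish; so one of the two invariants is a smooth
function of the other one. -/
theorem exists_isImplicitNear (hα : α ≠ 0) (hD : ∀ᶠ y in 𝓝 w, ContDiffAt ℝ ∞ D y) (hpos : 0 < D w)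
    (h1 : D w ≠ 1) (h : ∀ᶠ y in 𝓝 w, SolvesPDE α D y) :
    ∃ H : ℝ × ℝ → ℝ, ContDiff ℝ ∞ H ∧ IsImplicitNear α H D w := by
  have hDc : ContinuousAt D w := hD.self_of_nhds.continuousAt
  let k : Pair × Pair → ℝ := fun y => (invariants α (y, D y)).1
  let l : Pair × Pair → ℝ := fun y => (invariants α (y, D y)).2
  have hgood : ∀ᶠ y in 𝓝 w, ContDiffAt ℝ ∞ D y ∧ 0 < D y ∧ D y ≠ 1 ∧ SolvesPDE α D y ∧
      fderiv ℝ D y (fieldZ α (D y)) = 0 := by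
    filter_upwards [hD, hDc.eventually (lt_mem_nhds hpos), hDc.eventually_ne h1, h,
      h.eventually_nhds] with y a b c d e
    exact ⟨a, b, c, d,
      fderiv_fieldZ_eq_zero hα (a.of_le (WithTop.coe_le_coe.2 le_top)) b e⟩
  have hsmooth : ∀ᶠ y in 𝓝 w, ContDiffAt ℝ ∞ (fun y => invariants α (y, D y)) y := by
    filter_upwards [hgood] with y hy
    exact ContDiffAt.comp y (f := fun y => (y, D y)) (contDiffAt_invariants hα hy.2.1 hy.2.2.1)
      (contDiffAt_id.prodMk hy.1)
  have hks : ∀ᶠ y in 𝓝 w, ContDiffAt ℝ ∞ k y := hsmooth.mono fun y hy => hy.fst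
  have hls : ∀ᶠ y in 𝓝 w, ContDiffAt ℝ ∞ l y := hsmooth.mono fun y hy => hy.snd
  have hfd : ∀ y, ContDiffAt ℝ ∞ D y → 0 < D y → D y ≠ 1 → ∀ ξ,
      fderiv ℝ k y ξ = (fderiv ℝ (invariants α) (y, D y) (ξ, fderiv ℝ D y ξ)).1 ∧
      fderiv ℝ l y ξ = (fderiv ℝ (invariants α) (y, D y) (ξ, fderiv ℝ D y ξ)).2 := by
    intro y hy hy0 hy1 ξ
    have h2 := hasFDerivAt_invariants_graph hα (hy.differentiableAt (by simp)) hy0 hy1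
    exact ⟨by rw [h2.fst.fderiv]; rfl, by rw [h2.snd.fderiv]; rfl⟩
  have hker : ∀ᶠ y in 𝓝 w, (fderiv ℝ k y ≠ 0 → ∀ ξ, fderiv ℝ k y ξ = 0 → fderiv ℝ l y ξ = 0) ∧
      (fderiv ℝ l y ≠ 0 → ∀ ξ, fderiv ℝ l y ξ = 0 → fderiv ℝ k y ξ = 0) := by
    filter_upwards [hgood] with y ⟨hy, hy0, hy1, hp, hZ⟩
    have hYZ : fieldY α y (D y) ≠ (y.1.1 + y.1.2) • fieldZ α (D y) := by
      intro he
      have h2 := hp.eq_Y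
      rw [he, map_smul, hZ, smul_zero] at h2
      exact mul_ne_zero hy0.ne' (sub_ne_zero.2 (rpow_inv_ne_one hα hy0 hy1)) h2.symm
    have fd := hfd y hy hy0 hy1
    have kX : fderiv ℝ k y (fieldX (D y)) = 0 := by
      rw [(fd _).1, hp.eq_X, fderiv_invariants_fieldX hα hy0 hy1, Prod.fst_zero]
    have lX : fderiv ℝ l y (fieldX (D y)) = 0 := by
      rw [(fd _).2, hp.eq_X, fderiv_invariants_fieldX hα hy0 hy1, Prod.snd_zero]
    have kY : fderiv ℝ k y (fieldY α y (D y)) = 0 := by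
      rw [(fd _).1, hp.eq_Y, fderiv_invariants_fieldY hα hy0 hy1, Prod.fst_zero]
    have lY : fderiv ℝ l y (fieldY α y (D y)) = 0 := by
      rw [(fd _).2, hp.eq_Y, fderiv_invariants_fieldY hα hy0 hy1, Prod.snd_zero]
    have kZ : fderiv ℝ k y (fieldZ α (D y)) = 0 := by
      rw [(fd _).1, hZ, fderiv_invariants_fieldZ hα hy0 hy1, Prod.fst_zero]
    have lZ : fderiv ℝ l y (fieldZ α (D y)) = 0 := by
      rw [(fd _).2, hZ, fderiv_invariants_fieldZ hα hy0 hy1, Prod.snd_zero]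
    exact ⟨fun hne ξ hξ => apply_eq_zero_of_fields hne hYZ kX kY kZ lX lY lZ hξ,
      fun hne ξ hξ => apply_eq_zero_of_fields hne hYZ lX lY lZ kX kY kZ hξ⟩
  have hne : fderiv ℝ k w ≠ 0 ∨ fderiv ℝ l w ≠ 0 := by
    by_contra! hcon
    have fd := hfd w hD.self_of_nhds hpos h1
    set T := fderiv ℝ (invariants α) (w, D w) with hT
    have key : ∀ ξ, T (ξ, 0) + fderiv ℝ D w ξ • T (0, 1) = 0 := by
      intro ξ
      have h2 : T (ξ, fderiv ℝ D w ξ) = 0 := by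
        refine Prod.ext ?_ ?_
        · rw [← (fd ξ).1, hcon.1]; rfl
        · rw [← (fd ξ).2, hcon.2]; rfl
      rw [← h2, ← map_smul, ← map_add]
      simp
    obtain ⟨c, hc0, hcu⟩ := fderiv_invariants_u (w := w) hα hpos h1
    have hcv := fderiv_invariants_v (w := w) hα hpos h1
    have ku := key ((1, 0), (0, 0))
    have kv := congrArg Prod.fst (key ((0, 1), (0, 0)))
    rw [hT, hcu, ← hT] at ku
    have ku1 := congrArg Prod.fst ku
    have ku2 := congrArg Prod.snd ku
    simp only [Prod.fst_add, Prod.snd_add, Prod.smul_fst, Prod.smul_snd, smul_eq_mul, zero_add,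
      Prod.fst_zero, Prod.snd_zero] at ku1 ku2 kv
    rcases mul_eq_zero.1 ku1 with h2 | h2
    · rw [h2, zero_mul, add_zero] at ku2
      exact hc0 ku2
    · rw [h2, mul_zero, add_zero] at kv
      exact hcv kv
  have hDd : DifferentiableAt ℝ D w := hD.self_of_nhds.differentiableAt (by simp)
  have hne_ev : ∀ {g : Pair × Pair → ℝ}, (∀ᶠ y in 𝓝 w, ContDiffAt ℝ ∞ g y) → fderiv ℝ g w ≠ 0 →
      ∀ᶠ y in 𝓝 w, fderiv ℝ g y ≠ 0 := fun hg h0 =>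
    (hg.self_of_nhds.fderiv_right (m := 0) (by simp)).continuousAt.eventually_ne h0
  rcases hne with hk | hl
  · obtain ⟨φ, hφ, hφe⟩ := exists_contDiff_eventually_eq_comp hks hls hk
      (hker.and (hne_ev hks hk) |>.mono fun y hy => hy.1.1 hy.2)
    have hH : ContDiff ℝ ∞ fun q : ℝ × ℝ => q.2 - φ q.1 :=
      contDiff_snd.sub (hφ.comp contDiff_fst)
    refine ⟨_, hH, isImplicitNear_of_fderiv_ne_zero hα hDd hpos h1 (hH.differentiable (by simp))
      (hφe.mono fun y hy => sub_eq_zero.2 hy)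
      (fderiv_ne_zero_of_hasDerivAt_line (v := (0, 1)) (hH.differentiable (by simp) _) ?_)⟩
    simpa using ((hasDerivAt_id (0 : ℝ)).const_add (invariants α (w, D w)).2).sub_const
      (φ (invariants α (w, D w)).1)
  · obtain ⟨φ, hφ, hφe⟩ := exists_contDiff_eventually_eq_comp hls hks hl
      (hker.and (hne_ev hls hl) |>.mono fun y hy => hy.1.2 hy.2)
    have hH : ContDiff ℝ ∞ fun q : ℝ × ℝ => q.1 - φ q.2 :=
      contDiff_fst.sub (hφ.comp contDiff_snd)
    refine ⟨_, hH, isImplicitNear_of_fderiv_ne_zero hα hDd hpos h1 (hH.differentiable (by simp))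
      (hφe.mono fun y hy => sub_eq_zero.2 hy)
      (fderiv_ne_zero_of_hasDerivAt_line (v := (1, 0)) (hH.differentiable (by simp) _) ?_)⟩
    simpa using ((hasDerivAt_id (0 : ℝ)).const_add (invariants α (w, D w)).1).sub_const
      (φ (invariants α (w, D w)).2)

end Implicit

/-! ### Shifts of `I₁` and `J₁`, and local solutions -/

/-- The value of `𝒟₁` that is forced by the value `r` of `u_{1x}`: the quotient
`E = (u_{1x} / (u₁ + v₁)) / (u_x / (u + v))`, raised to the power `α`. -/
def multiplier (α : ℝ) (q qx q₁ : Pair) (r : ℝ) : ℝ :=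
  ((r / (q₁.1 + q₁.2)) / (qx.1 / (q.1 + q.2))) ^ α

/-- `𝒟₁` as a function on sites, computed from the right-hand side `f` of the first equation. -/
def siteMultiplier (α : ℝ) (f : Site → ℝ) (σ : Site) : ℝ :=
  multiplier α σ.2.1 σ.2.2.1 σ.2.2.2 (f σ)

/-- The inclusion of the variables `(u, v), (u₁, v₁)` into the variables of a site. -/
def siteIncl : Pair × Pair →L[ℝ] Site :=
  (0 : Pair × Pair →L[ℝ] ℝ).prod ((ContinuousLinearMap.fst ℝ Pair Pair).prod
    ((0 : Pair × Pair →L[ℝ] Pair).prod (ContinuousLinearMap.snd ℝ Pair Pair)))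

theorem siteIncl_apply (w : Pair × Pair) : siteIncl w = (0, w.1, 0, w.2) := rfl

/-- The shift `DI₁ = I₁` in terms of `p = u_x / (u + v)` and its shift `p₁`: it determines
`v_{1x}`. -/
theorem I₁_shift_iff {α p p₁ v v₁ vx r : ℝ} (hp : 0 < p) (hp₁ : 0 < p₁) :
    (1 + 1 / α) * v₁ * p₁ ^ (1 - α) - r * p₁ ^ (-α) =
        (1 + 1 / α) * v * p ^ (1 - α) - vx * p ^ (-α) ↔
      r = (1 + 1 / α) * (v₁ * (p₁ / p) - v * (p₁ / p) ^ α) * p + (p₁ / p) ^ α * vx := by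
  have hE : 0 < p₁ / p := div_pos hp₁ hp
  have e1 : ∀ y : ℝ, 0 < y → y ^ (1 - α) = y * y ^ (-α) := fun y hy => by
    rw [sub_eq_add_neg, Real.rpow_add hy, Real.rpow_one]
  have e2 : p₁ ^ (-α) = p ^ (-α) * ((p₁ / p) ^ α)⁻¹ := by
    rw [← Real.rpow_neg hE.le, ← Real.mul_rpow hp.le hE.le, mul_div_cancel₀ _ hp.ne']
  have e3 : p₁ = (p₁ / p) * p := by field_simp
  rw [e1 p hp, e1 p₁ hp₁, e2]
  have hP : 0 < p ^ (-α) := Real.rpow_pos_of_pos hp _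
  have hd : 0 < (p₁ / p) ^ α := Real.rpow_pos_of_pos hE _
  generalize (p₁ / p) ^ α = d at *
  generalize p₁ / p = E at *
  generalize p ^ (-α) = P at *
  subst e3
  constructor
  · intro h
    apply mul_left_cancel₀ (mul_pos hP (inv_pos.2 hd)).ne'
    have h2 : P * d⁻¹ * d = P := by field_simp
    linear_combination -h + ((1 + 1 / α) * v * p - vx) * h2
  · rintro rfl
    field_simp
    ring

/-- The shift `DJ₁ = J₁` says how `𝒟₁` changes along a solution. -/
theorem J₁_shift_iff {α : ℝ} (hα : α ≠ 0) {u v u₁ v₁ ux u₁x : ℝ → ℝ} {x vx v₁x uxx u₁xx δ' : ℝ}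
    (hu : HasDerivAt u (ux x) x) (hv : HasDerivAt v vx x) (hu₁ : HasDerivAt u₁ (u₁x x) x)
    (hv₁ : HasDerivAt v₁ v₁x x) (hux : HasDerivAt ux uxx x) (hu₁x : HasDerivAt u₁x u₁xx x)
    (hp : 0 < ux x / (u x + v x)) (hp₁ : 0 < u₁x x / (u₁ x + v₁ x)) {δ : ℝ → ℝ}
    (hδ : δ =ᶠ[𝓝 x] fun t => ((u₁x t / (u₁ t + v₁ t)) / (ux t / (u t + v t))) ^ α)
    (hδ' : HasDerivAt δ δ' x) :
    u₁xx / u₁x x - ((α + 1) * u₁x x + α * v₁x) / (α * (u₁ x + v₁ x)) =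
        uxx / ux x - ((α + 1) * ux x + α * vx) / (α * (u x + v x)) ↔
      δ' = ux x / (u x + v x) * (δ x * (δ x ^ (1 / α) - 1)) := by
  have hux0 : ux x ≠ 0 := by rintro h; simp [h] at hp
  have hu₁x0 : u₁x x ≠ 0 := by rintro h; simp [h] at hp₁
  have huv0 : u x + v x ≠ 0 := by rintro h; simp [h] at hp
  have huv₁0 : u₁ x + v₁ x ≠ 0 := by rintro h; simp [h] at hp₁
  have hE := div_pos hp₁ hp
  have h1 := ((hu₁x.div (hu₁.add hv₁) huv₁0).div (hux.div (hu.add hv) huv0) hp.ne').rpow_const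
    (p := α) (Or.inl hE.ne')
  have h2 := hδ'.unique (h1.congr_of_eventuallyEq hδ)
  have h3 : δ x = ((u₁x x / (u₁ x + v₁ x)) / (ux x / (u x + v x))) ^ α := hδ.self_of_nhds
  have h4 : δ x ^ (1 / α) = (u₁x x / (u₁ x + v₁ x)) / (ux x / (u x + v x)) := by
    rw [h3, ← Real.rpow_mul hE.le, mul_one_div_cancel hα, Real.rpow_one]
  have hδ0 : 0 < δ x := h3 ▸ Real.rpow_pos_of_pos hE α
  simp only [Pi.div_apply, Pi.add_apply] at h2
  rw [Real.rpow_sub hE, Real.rpow_one, ← h3] at h2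
  rw [h2, h4]
  generalize δ x = d at *
  generalize u x = a at *
  generalize v x = b at *
  generalize u₁ x = a₁ at *
  generalize v₁ x = b₁ at *
  generalize ux x = c at *
  generalize u₁x x = c₁ at *
  rw [← sub_eq_zero, ← sub_eq_zero (b := c / (a + b) * _)]
  have key : ∀ A B m : ℝ, m ≠ 0 → B = m * A → (A = 0 ↔ B = 0) := by
    rintro A B m hm rfl
    simp [hm]
  apply key _ _ (α * d) (mul_ne_zero hα hδ0.ne')
  field_simp
  ring

section Solutions

variable {f g : ℕ → Site → ℝ} {Ω : ℕ → Set Site} {a b n : ℕ} {s : Set ℝ} {u v : ℕ → ℝ → ℝ} {x : ℝ}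

theorem hasDerivAt_of_contDiffOn_two {y : ℝ → ℝ} (hs : IsOpen s) (h : ContDiffOn ℝ 2 y s)
    (hx : x ∈ s) :
    HasDerivAt y (deriv y x) x ∧ HasDerivAt (deriv y) (deriv (deriv y) x) x := by
  have h1 : ContDiffOn ℝ 1 (deriv y) s :=
    ((contDiffOn_succ_iff_deriv_of_isOpen (n := 1) hs).1 (by rwa [one_add_one_eq_two])).2.2
  exact ⟨((h.contDiffAt (hs.mem_nhds hx)).differentiableAt (by simp)).hasDerivAt,
    ((h1.contDiffAt (hs.mem_nhds hx)).differentiableAt (by simp)).hasDerivAt⟩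

/-- Every site of the domain, together with every value of `(u_xx, v_xx)`, is attained on a local
solution: `u, v` at `n` are taken quadratic in `x`, and `u₁, v₁` solve an ordinary differential
equation. -/
theorem exists_isSolutionOn (hΩ : IsOpen (Ω n)) (hf : ContDiffOn ℝ ∞ (f n) (Ω n))
    (hg : ContDiffOn ℝ ∞ (g n) (Ω n)) {σ : Site} (hσ : σ ∈ Ω n) (qxx : Pair) :
    ∃ (s : Set ℝ) (u v : ℕ → ℝ → ℝ), IsSolutionOn f g Ω n (n + 1) s u v ∧ σ.1 ∈ s ∧
      siteOf u v n σ.1 = σ ∧ deriv (deriv (u n)) σ.1 = qxx.1 ∧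
      deriv (deriv (v n)) σ.1 = qxx.2 := by
  obtain ⟨x₀, ⟨u₀, v₀⟩, ⟨ux, vx⟩, q₁⟩ := σ
  obtain ⟨uxx, vxx⟩ := qxx
  let quad : ℝ → ℝ → ℝ → ℝ → ℝ := fun c c' c'' t =>
    c + c' * (t - x₀) + c'' / 2 * ((t - x₀) * (t - x₀))
  have hquad : ∀ c c' c'', deriv (quad c c' c'') = fun t => c' + c'' * (t - x₀) := by
    intro c c' c''
    funext t
    have h1 : HasDerivAt (fun t => t - x₀) 1 t := (hasDerivAt_id t).sub_const x₀
    have h2 := ((h1.const_mul c').const_add c).add ((h1.mul h1).const_mul (c'' / 2))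
    refine h2.deriv.trans ?_
    ring
  have hquad2 : ∀ c c' c'', deriv (deriv (quad c c' c'')) x₀ = c'' := by
    intro c c' c''
    rw [hquad]
    simp
  have hquadc : ∀ c c' c'', ContDiff ℝ 2 (quad c c' c'') := by
    intro c c' c''
    fun_prop
  let S : ℝ × Pair → Site := fun z =>
    (z.1, (quad u₀ ux uxx z.1, quad v₀ vx vxx z.1),
      (ux + uxx * (z.1 - x₀), vx + vxx * (z.1 - x₀)), z.2)
  have hS : ContDiff ℝ 1 S := by fun_prop
  have hS0 : S (x₀, q₁) = (x₀, (u₀, v₀), (ux, vx), q₁) := by simp [S, quad]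
  have hF : ∀ {h : Site → ℝ}, ContDiffOn ℝ ∞ h (Ω n) →
      ContDiffAt ℝ 1 (fun z => h (S z)) (x₀, q₁) := by
    intro h hh
    refine ContDiffAt.comp (x₀, q₁) (f := S) ?_ hS.contDiffAt
    rw [hS0]
    exact ((hh.contDiffAt (hΩ.mem_nhds hσ))).of_le (by exact_mod_cast le_top)
  obtain ⟨y, s, hs, hxs, hy0, hy2, hyd⟩ :=
    exists_isOpen_contDiffOn_hasDerivAt ((hF hf).prodMk (hF hg))
  have hSy : ContinuousOn (fun t => S (t, y t)) s :=
    hS.continuous.comp_continuousOn (continuousOn_id.prodMk hy2.continuousOn)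
  let U : ℕ → ℝ → ℝ := fun m => if m = n then quad u₀ ux uxx else fun t => (y t).1
  let V : ℕ → ℝ → ℝ := fun m => if m = n then quad v₀ vx vxx else fun t => (y t).2
  have hUn : U n = quad u₀ ux uxx := by simp [U]
  have hVn : V n = quad v₀ vx vxx := by simp [V]
  have hU1 : U (n + 1) = fun t => (y t).1 := by simp [U]
  have hV1 : V (n + 1) = fun t => (y t).2 := by simp [V]
  have hsite : ∀ t, siteOf U V n t = S (t, y t) := by
    intro t
    simp only [siteOf, hUn, hVn, hU1, hV1, hquad, S]
  set s' := s ∩ (fun t => S (t, y t)) ⁻¹' Ω n with hs'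
  have hn : ∀ m ∈ Icc n (n + 1), m = n ∨ m = n + 1 := fun m hm => by
    have := hm.1; have := hm.2; omega
  have hn' : ∀ m ∈ Ico n (n + 1), m = n := fun m hm => by
    have := hm.1; have := hm.2; omega
  refine ⟨s', U, V, ⟨hSy.isOpen_inter_preimage hs hΩ, ?_, ?_, ?_, ?_, ?_⟩, ⟨hxs, ?_⟩, ?_, ?_, ?_⟩
  · intro m hm
    rcases hn m hm with rfl | rfl
    · rw [hUn]; exact (hquadc _ _ _).contDiffOn
    · rw [hU1]; exact hy2.fst.mono inter_subset_left
  · intro m hm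
    rcases hn m hm with rfl | rfl
    · rw [hVn]; exact (hquadc _ _ _).contDiffOn
    · rw [hV1]; exact hy2.snd.mono inter_subset_left
  · intro m hm t ht
    rw [hn' m hm, hsite]
    exact ht.2
  · intro m hm t ht
    rw [hn' m hm, hsite, hU1]
    have h1 : HasDerivAt (fun t => (y t).1) (f n (S (t, y t))) t := (hyd t ht.1).fst
    exact h1.deriv
  · intro m hm t ht
    rw [hn' m hm, hsite, hV1]
    have h1 : HasDerivAt (fun t => (y t).2) (g n (S (t, y t))) t := (hyd t ht.1).snd
    exact h1.deriv
  · simpa [hy0, hS0] using hσ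
  · rw [hsite, hy0, hS0]
  · rw [hUn]; exact hquad2 _ _ _
  · rw [hVn]; exact hquad2 _ _ _

variable {α : ℝ}

/-- On a solution along which `u_{1x} / (u₁ + v₁)` is positive, `DJ₁ = J₁` at a point is an equation
for the derivative of `𝒟₁`. -/
theorem J₁_jetOf_shift_iff (hα : α ≠ 0) (hsol : IsSolutionOn f g Ω a b s u v) (hn : n ∈ Ico a b)
    (hx : x ∈ s) (hp : 0 < deriv (u n) x / (u n x + v n x))
    (hp₁ : 0 < deriv (u (n + 1)) x / (u (n + 1) x + v (n + 1) x)) {δ' : ℝ}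
    (hδ' : HasDerivAt (fun t => siteMultiplier α (f n) (siteOf u v n t)) δ' x) :
    J₁ α x (n + 1) (jetOf u v (n + 1) x) = J₁ α x n (jetOf u v n x) ↔
      δ' = deriv (u n) x / (u n x + v n x) * (siteMultiplier α (f n) (siteOf u v n x) *
        (siteMultiplier α (f n) (siteOf u v n x) ^ (1 / α) - 1)) := by
  have hn0 : n ∈ Icc a b := Ico_subset_Icc_self hn
  have hn1 : n + 1 ∈ Icc a b := ⟨hn.1.trans (Nat.le_succ n), hn.2⟩
  obtain ⟨hu, hux⟩ := hasDerivAt_of_contDiffOn_two hsol.isOpen (hsol.contDiffOn_u n hn0) hx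
  obtain ⟨hv, -⟩ := hasDerivAt_of_contDiffOn_two hsol.isOpen (hsol.contDiffOn_v n hn0) hx
  obtain ⟨hu₁, hu₁x⟩ := hasDerivAt_of_contDiffOn_two hsol.isOpen (hsol.contDiffOn_u _ hn1) hx
  obtain ⟨hv₁, -⟩ := hasDerivAt_of_contDiffOn_two hsol.isOpen (hsol.contDiffOn_v _ hn1) hx
  refine J₁_shift_iff hα hu hv hu₁ hv₁ hux hu₁x hp hp₁ ?_ hδ'
  filter_upwards [hsol.isOpen.mem_nhds hx] with t ht
  rw [hsol.eq_u n hn t ht]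
  rfl

end Solutions

/-! ### From integrals to the explicit form, and back -/

section Necessity

variable {α : ℝ} {Ω : ℕ → Set Site} {f g : ℕ → Site → ℝ} {n : ℕ} {σ : Site}

/-- Invariance of `I₁` makes `u_{1x} / (u₁ + v₁)` positive and determines `v_{1x}`. -/
theorem IsNIntegral.site_eq (hI : IsNIntegral f g Ω domI (I₁ α)) (hΩ : IsOpen (Ω n))
    (hΩ_pos : ∀ σ ∈ Ω n, 0 < σ.2.2.1.1 / (σ.2.1.1 + σ.2.1.2) ∧ σ.2.2.2.1 + σ.2.2.2.2 ≠ 0)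
    (hf : ContDiffOn ℝ ∞ (f n) (Ω n)) (hg : ContDiffOn ℝ ∞ (g n) (Ω n)) (hσ : σ ∈ Ω n) :
    0 < f n σ / (σ.2.2.2.1 + σ.2.2.2.2) ∧
      g n σ = (1 + 1 / α) * (σ.2.2.2.2 * ((f n σ / (σ.2.2.2.1 + σ.2.2.2.2)) /
          (σ.2.2.1.1 / (σ.2.1.1 + σ.2.1.2))) - σ.2.1.2 * siteMultiplier α (f n) σ) *
            (σ.2.2.1.1 / (σ.2.1.1 + σ.2.1.2)) + siteMultiplier α (f n) σ * σ.2.2.1.2 := by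
  obtain ⟨s, u, v, hsol, hx, hsite, -, -⟩ := exists_isSolutionOn hΩ hf hg hσ 0
  generalize σ.1 = x at hx hsite
  subst hsite
  have hn : n ∈ Ico n (n + 1) := by simp
  have hpos := (hΩ_pos _ hσ).1
  obtain ⟨hdom, heq⟩ := hI n (n + 1) s u v hsol n hn x hx hpos
  have hp₁ : 0 < f n (siteOf u v n x) / (u (n + 1) x + v (n + 1) x) := by
    rw [← hsol.eq_u n hn x hx]
    exact hdom
  refine ⟨hp₁, ?_⟩
  have heq' : (1 + 1 / α) * v (n + 1) x *
      (f n (siteOf u v n x) / (u (n + 1) x + v (n + 1) x)) ^ (1 - α) - g n (siteOf u v n x) *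
        (f n (siteOf u v n x) / (u (n + 1) x + v (n + 1) x)) ^ (-α) =
      (1 + 1 / α) * v n x * (deriv (u n) x / (u n x + v n x)) ^ (1 - α) -
        deriv (v n) x * (deriv (u n) x / (u n x + v n x)) ^ (-α) := by
    rw [← hsol.eq_u n hn x hx, ← hsol.eq_v n hn x hx]
    exact heq
  exact (I₁_shift_iff hpos hp₁).1 heq'

theorem contDiffOn_siteMultiplier {F : Site → ℝ} {S : Set Site}
    (hpos : ∀ σ ∈ S, 0 < σ.2.2.1.1 / (σ.2.1.1 + σ.2.1.2) ∧
      0 < F σ / (σ.2.2.2.1 + σ.2.2.2.2))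
    (hF : ContDiffOn ℝ ∞ F S) : ContDiffOn ℝ ∞ (siteMultiplier α F) S := by
  have c1 : ContDiffOn ℝ ∞ (fun σ : Site => σ.2.2.2.1 + σ.2.2.2.2) S := by fun_prop
  have c2 : ContDiffOn ℝ ∞ (fun σ : Site => σ.2.1.1 + σ.2.1.2) S := by fun_prop
  have c3 : ContDiffOn ℝ ∞ (fun σ : Site => σ.2.2.1.1) S := by fun_prop
  have h1 : ∀ σ ∈ S, σ.2.2.2.1 + σ.2.2.2.2 ≠ 0 := fun σ hσ h => by
    simpa [h] using (hpos σ hσ).2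
  have h2 : ∀ σ ∈ S, σ.2.1.1 + σ.2.1.2 ≠ 0 := fun σ hσ h => by
    simpa [h] using (hpos σ hσ).1
  exact ((hF.div c1 h1).div (c3.div c2 h2) fun σ hσ => (hpos σ hσ).1.ne').rpow_const_of_ne
    fun σ hσ => (div_pos (hpos σ hσ).2 (hpos σ hσ).1).ne'

/-- Invariance of `J₁` as a differential equation for `𝒟₁` on the domain: the values of the second
derivatives are arbitrary. -/
theorem IsNIntegral.fderiv_siteMultiplier (hα : α ≠ 0) (hJ : IsNIntegral f g Ω domJ (J₁ α))
    (hΩ : IsOpen (Ω n))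
    (hpos : ∀ σ ∈ Ω n, 0 < σ.2.2.1.1 / (σ.2.1.1 + σ.2.1.2) ∧
      0 < f n σ / (σ.2.2.2.1 + σ.2.2.2.2))
    (hf : ContDiffOn ℝ ∞ (f n) (Ω n)) (hg : ContDiffOn ℝ ∞ (g n) (Ω n)) (hσ : σ ∈ Ω n)
    (qxx : Pair) :
    fderiv ℝ (siteMultiplier α (f n)) σ (1, σ.2.2.1, qxx, (f n σ, g n σ)) =
      σ.2.2.1.1 / (σ.2.1.1 + σ.2.1.2) * (siteMultiplier α (f n) σ *
        (siteMultiplier α (f n) σ ^ (1 / α) - 1)) := by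
  obtain ⟨s, u, v, hsol, hx, hsite, huxx, hvxx⟩ := exists_isSolutionOn hΩ hf hg hσ qxx
  set x := σ.1 with hxdef
  have hn : n ∈ Ico n (n + 1) := by simp
  have hn1 : n + 1 ∈ Icc n (n + 1) := by simp
  have hn0 : n ∈ Icc n (n + 1) := by simp
  have hδ : HasFDerivAt (siteMultiplier α (f n)) (fderiv ℝ (siteMultiplier α (f n)) σ)
      (siteOf u v n x) := by
    rw [hsite]
    exact (((contDiffOn_siteMultiplier hpos hf).contDiffAt (hΩ.mem_nhds hσ)).differentiableAt
      (by simp)).hasFDerivAt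
  obtain ⟨hu, hux⟩ := hasDerivAt_of_contDiffOn_two hsol.isOpen (hsol.contDiffOn_u n hn0) hx
  obtain ⟨hv, hvx⟩ := hasDerivAt_of_contDiffOn_two hsol.isOpen (hsol.contDiffOn_v n hn0) hx
  obtain ⟨hu₁, -⟩ := hasDerivAt_of_contDiffOn_two hsol.isOpen (hsol.contDiffOn_u _ hn1) hx
  obtain ⟨hv₁, -⟩ := hasDerivAt_of_contDiffOn_two hsol.isOpen (hsol.contDiffOn_v _ hn1) hx
  rw [hsol.eq_u n hn x hx, hsite] at hu₁
  rw [hsol.eq_v n hn x hx, hsite] at hv₁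
  have hcurve : HasDerivAt (fun t => siteOf u v n t)
      (1, (deriv (u n) x, deriv (v n) x), (qxx.1, qxx.2), (f n σ, g n σ)) x := by
    rw [huxx] at hux
    rw [hvxx] at hvx
    exact (hasDerivAt_id x).prodMk ((hu.prodMk hv).prodMk ((hux.prodMk hvx).prodMk
      (hu₁.prodMk hv₁)))
  have hpσ := hpos σ hσ
  have hp : 0 < deriv (u n) x / (u n x + v n x) := by
    rw [← hsite] at hpσ
    exact hpσ.1
  have hp₁ : 0 < deriv (u (n + 1)) x / (u (n + 1) x + v (n + 1) x) := by
    rw [hsol.eq_u n hn x hx]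
    rw [← hsite] at hpσ
    exact hpσ.2
  have hdom : jetOf u v n x ∈ domJ :=
    ⟨fun h => by simp [show deriv (u n) x = 0 from h] at hp,
      fun h => by simp [show u n x + v n x = 0 from h] at hp⟩
  have key := (J₁_jetOf_shift_iff hα hsol hn hx hp hp₁ (hδ.comp_hasDerivAt x hcurve)).1
    (hJ n (n + 1) s u v hsol n hn x hx hdom).2
  have hqx : σ.2.2.1 = (deriv (u n) x, deriv (v n) x) := by rw [← hsite]; rfl
  have hq : σ.2.1 = (u n x, v n x) := by rw [← hsite]; rfl
  rw [hsite] at key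
  rw [hqx, hq]
  exact key

/-- Invariance of `I₁` and `J₁` at the level of sites: `𝒟₁` does not depend on `x`, `u_x`, `v_x`,
and solves the quasilinear system. -/
theorem fderiv_siteMultiplier_fields (hα : α ≠ 0) {F G : Site → ℝ} {S : Set Site} (hS : IsOpen S)
    (hpos : ∀ σ ∈ S, 0 < σ.2.2.1.1 / (σ.2.1.1 + σ.2.1.2) ∧
      0 < F σ / (σ.2.2.2.1 + σ.2.2.2.2))
    (hF : ContDiffOn ℝ ∞ F S)
    (hG : ∀ σ ∈ S, G σ = (1 + 1 / α) * (σ.2.2.2.2 * ((F σ / (σ.2.2.2.1 + σ.2.2.2.2)) /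
          (σ.2.2.1.1 / (σ.2.1.1 + σ.2.1.2))) - σ.2.1.2 * siteMultiplier α F σ) *
            (σ.2.2.1.1 / (σ.2.1.1 + σ.2.1.2)) + siteMultiplier α F σ * σ.2.2.1.2)
    (hJ : ∀ σ ∈ S, ∀ qxx : Pair, fderiv ℝ (siteMultiplier α F) σ (1, σ.2.2.1, qxx, (F σ, G σ)) =
      σ.2.2.1.1 / (σ.2.1.1 + σ.2.1.2) * (siteMultiplier α F σ *
        (siteMultiplier α F σ ^ (1 / α) - 1))) (hσ : σ ∈ S) :
    (∀ (c : ℝ) (qxx : Pair), fderiv ℝ (siteMultiplier α F) σ (c, 0, qxx, 0) = 0) ∧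
      fderiv ℝ (siteMultiplier α F) σ (siteIncl (fieldX (siteMultiplier α F σ))) = 0 ∧
      fderiv ℝ (siteMultiplier α F) σ
          (siteIncl (fieldY α (σ.2.1, σ.2.2.2) (siteMultiplier α F σ))) =
        siteMultiplier α F σ * (siteMultiplier α F σ ^ (1 / α) - 1) := by
  set δ := siteMultiplier α F with hδ
  have hδd : DifferentiableOn ℝ δ S :=
    (contDiffOn_siteMultiplier hpos hF).differentiableOn (by simp)
  -- The right-hand side of `hJ` does not contain `qxx`.
  have hqxx : ∀ σ ∈ S, ∀ qxx : Pair, fderiv ℝ δ σ (0, 0, qxx, 0) = 0 := by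
    intro σ hσ qxx
    have h1 := hJ σ hσ qxx
    rw [← hJ σ hσ 0, ← sub_eq_zero, ← map_sub] at h1
    simpa using h1
  obtain ⟨x, q, qx, q₁⟩ := σ
  obtain ⟨r, hr, hball⟩ := Metric.isOpen_iff.1 hS _ hσ
  have hmem : ∀ {x' q' qx' q₁'}, dist x' x < r → dist q' q < r → dist qx' qx < r →
      dist q₁' q₁ < r → ((x', q', qx', q₁') : Site) ∈ S := fun h1 h2 h3 h4 => hball (by
    simp only [Metric.mem_ball, Prod.dist_eq, max_lt_iff] at *
    exact ⟨h1, h2, h3, h4⟩)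
  -- Near the site, `δ` does not depend on `(u_x, v_x)`.
  have hindep : ∀ {x' q' qx' q₁'}, dist x' x < r → dist q' q < r → dist qx' qx < r →
      dist q₁' q₁ < r → δ (x', q', qx', q₁') = δ (x', q', qx, q₁') := by
    intro x' q' qx' q₁' h1 h2 h3 h4
    have hline : ∀ y : Pair, HasFDerivAt (fun y : Pair => ((x', q', y, q₁') : Site))
        ((0 : Pair →L[ℝ] ℝ).prod ((0 : Pair →L[ℝ] Pair).prod
          ((ContinuousLinearMap.id ℝ Pair).prod (0 : Pair →L[ℝ] Pair)))) y := fun y =>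
      (hasFDerivAt_const x' y).prodMk ((hasFDerivAt_const q' y).prodMk
        ((hasFDerivAt_id y).prodMk (hasFDerivAt_const q₁' y)))
    have hd : ∀ y ∈ Metric.ball qx r, HasFDerivAt (fun y : Pair => δ (x', q', y, q₁'))
        (0 : Pair →L[ℝ] ℝ) y := by
      intro y hy
      have hyS := hmem h1 h2 hy h4
      have h5 := ((hδd.differentiableAt (hS.mem_nhds hyS)).hasFDerivAt).comp y (hline y)
      convert! h5 using 1
      ext1 <;> ext1 <;> exact (hqxx _ hyS _).symm
    exact Metric.isOpen_ball.is_const_of_fderiv_eq_zero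
      (convex_ball qx r).isPreconnected
      (fun y hy => (hd y hy).differentiableAt.differentiableWithinAt)
      (fun y hy => (hd y hy).fderiv) (x := qx') (y := qx) h3 (Metric.mem_ball_self hr)
  have hfd : ∀ {qx'}, dist qx' qx < r →
      fderiv ℝ δ (x, q, qx', q₁) = fderiv ℝ δ (x, q, qx, q₁) := by
    intro qx' h
    have h0 : ((x, q, qx', q₁) : Site) = (x, q, qx, q₁) + (0, 0, qx' - qx, 0) := by simp
    rw [h0, ← fderiv_comp_add_right]
    refine Filter.EventuallyEq.fderiv_eq ?_
    have hnear : ∀ᶠ τ in 𝓝 ((x, q, qx, q₁) : Site), dist τ (x, q, qx, q₁) < r - dist qx' qx :=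
      Metric.ball_mem_nhds _ (sub_pos.2 h)
    filter_upwards [hnear] with τ hτ
    obtain ⟨x', q', qx'', q₁'⟩ := τ
    have hmax : max (dist x' x) (max (dist q' q) (max (dist qx'' qx) (dist q₁' q₁))) <
        r - dist qx' qx := hτ
    obtain ⟨h1, h2, h3, h4⟩ : _ ∧ _ ∧ _ ∧ _ := by simpa only [max_lt_iff] using hmax
    have hnn : 0 ≤ dist qx' qx := dist_nonneg
    have h5 : dist (qx'' + (qx' - qx)) qx < r := by
      calc dist (qx'' + (qx' - qx)) qx ≤ dist qx'' qx + dist qx' qx := by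
            rw [dist_eq_norm, dist_eq_norm, dist_eq_norm]
            have : qx'' + (qx' - qx) - qx = (qx'' - qx) + (qx' - qx) := by abel
            rw [this]
            exact norm_add_le _ _
        _ < r := by linarith
    have e1 : δ (x', q', qx'' + (qx' - qx), q₁') = δ (x', q', qx, q₁') :=
      hindep (by linarith) (by linarith) h5 (by linarith)
    have e2 : δ (x', q', qx'', q₁') = δ (x', q', qx, q₁') :=
      hindep (by linarith) (by linarith) (by linarith) (by linarith)
    simp only [Prod.mk_add_mk, add_zero]
    rw [e1, e2]
  obtain ⟨u, v⟩ := q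
  obtain ⟨ux, vx⟩ := qx
  obtain ⟨u₁, v₁⟩ := q₁
  set d := δ (x, (u, v), (ux, vx), (u₁, v₁)) with hd
  set A := fderiv ℝ δ (x, (u, v), (ux, vx), (u₁, v₁)) with hA
  have hpσ := hpos _ hσ
  have huv : u + v ≠ 0 := by
    rintro h; simp [h] at hpσ
  have huv₁ : u₁ + v₁ ≠ 0 := by
    rintro h; simp [h] at hpσ
  -- The differential equation at nearby sites that differ from the given one in `(u_x, v_x)` only.
  have key : ∀ ux' vx', dist ((ux', vx') : Pair) (ux, vx) < r →
      A (1, 0, 0, 0) + ux' / (u + v) * A (siteIncl (fieldY α ((u, v), (u₁, v₁)) d)) +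
        vx' * A (siteIncl (fieldX d)) = ux' / (u + v) * (d * (d ^ (1 / α) - 1)) := by
    intro ux' vx' h
    have hσ' : ((x, (u, v), (ux', vx'), (u₁, v₁)) : Site) ∈ S :=
      hmem (by simpa using hr) (by simpa using hr) h (by simpa using hr)
    have h1 : δ (x, (u, v), (ux', vx'), (u₁, v₁)) = d :=
      hindep (by simpa using hr) (by simpa using hr) h (by simpa using hr)
    have h2 := hJ _ hσ' 0
    have h3 := hG _ hσ'
    have h4 := hpos _ hσ'
    simp only at h2 h3 h4
    rw [hfd h, h1] at h2
    rw [h1] at h3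
    have hE : d ^ (1 / α) = F (x, (u, v), (ux', vx'), (u₁, v₁)) / (u₁ + v₁) / (ux' / (u + v)) := by
      rw [← h1, hδ, siteMultiplier, multiplier, ← Real.rpow_mul (div_pos h4.2 h4.1).le,
        mul_one_div_cancel hα, Real.rpow_one]
    have hux' : ux' ≠ 0 := by rintro h; simp [h] at h4
    have hF' : F (x, (u, v), (ux', vx'), (u₁, v₁)) = (u₁ + v₁) * d ^ (1 / α) * (ux' / (u + v)) := by
      rw [hE]; field_simp
    rw [← hE] at h3
    have hvec : ((1, (ux', vx'), 0, ((u₁ + v₁) * d ^ (1 / α) * (ux' / (u + v)),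
        (1 + 1 / α) * (v₁ * d ^ (1 / α) - v * d) * (ux' / (u + v)) + d * vx')) : Site) =
        (1, 0, 0, 0) + (ux' / (u + v)) • siteIncl (fieldY α ((u, v), (u₁, v₁)) d) +
          vx' • siteIncl (fieldX d) := by
      simp only [siteIncl_apply, fieldX, fieldY, Prod.smul_mk, Prod.mk_add_mk, smul_eq_mul,
        mul_zero, smul_zero, add_zero, zero_add, mul_one, Prod.mk.injEq, true_and]
      refine ⟨?_, ?_, ?_⟩
      · simp [huv]
      · ring
      · ring
    rw [← h2, h3, hF', hvec, map_add, map_add, map_smul, map_smul, smul_eq_mul, smul_eq_mul]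
  have k0 := key ux vx (by simpa using hr)
  have hr2 : |r| / 2 < r := by rw [abs_of_pos hr]; linarith
  have k1 := key (ux + r / 2) vx (by
    simpa [Prod.dist_eq, Real.dist_eq] using ⟨hr2, hr⟩)
  have k2 := key ux (vx + r / 2) (by
    simpa [Prod.dist_eq, Real.dist_eq] using ⟨hr, hr2⟩)
  have hX : A (siteIncl (fieldX d)) = 0 := by
    have : r / 2 * A (siteIncl (fieldX d)) = 0 := by linear_combination k2 - k0
    exact (mul_eq_zero.1 this).resolve_left (by positivity)
  have hY : A (siteIncl (fieldY α ((u, v), (u₁, v₁)) d)) = d * (d ^ (1 / α) - 1) := by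
    have : r / 2 / (u + v) * (A (siteIncl (fieldY α ((u, v), (u₁, v₁)) d)) -
        d * (d ^ (1 / α) - 1)) = 0 := by linear_combination k1 - k0
    exact sub_eq_zero.1 ((mul_eq_zero.1 this).resolve_left (div_ne_zero (by positivity) huv))
  have hx0 : A (1, 0, 0, 0) = 0 := by
    rw [hX, hY] at k0
    linear_combination k0
  refine ⟨fun c qxx => ?_, hX, hY⟩
  have h1 : ((c, 0, qxx, 0) : Site) = c • (1, 0, 0, 0) + (0, 0, qxx, 0) := by simp
  rw [h1, map_add, map_smul, hx0, hqxx _ hσ, smul_zero, add_zero]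

theorem isOpen_baseOf {S : Set Site} (hS : IsOpen S) : IsOpen (baseOf S) := by
  have h : baseOf S =
      ⋃ p : ℝ × Pair, (fun w : Pair × Pair => ((p.1, w.1, p.2, w.2) : Site)) ⁻¹' S := by
    ext w
    simp [baseOf]
  rw [h]
  exact isOpen_iUnion fun p => hS.preimage (by fun_prop)

open Classical in
/-- `𝒟₁` as a function of `(u, v), (u₁, v₁)`: the value of `siteMultiplier` at any site over the
point, and `1` where there is no such site. -/
def baseMultiplier (α : ℝ) (F : Site → ℝ) (S : Set Site) (w : Pair × Pair) : ℝ :=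
  if h : ∃ p : ℝ × Pair, (p.1, w.1, p.2, w.2) ∈ S then
    siteMultiplier α F (h.choose.1, w.1, h.choose.2, w.2) else 1

/-- On connected fibres, a `siteMultiplier` with zero derivative along the fibres descends. -/
theorem baseMultiplier_eq {F : Site → ℝ} {S : Set Site} (hS : IsOpen S)
    (hfib : ∀ q q₁ : Pair, IsPreconnected {p : ℝ × Pair | (p.1, q, p.2, q₁) ∈ S})
    (hd : DifferentiableOn ℝ (siteMultiplier α F) S)
    (h0 : ∀ σ ∈ S, ∀ (c : ℝ) (qxx : Pair), fderiv ℝ (siteMultiplier α F) σ (c, 0, qxx, 0) = 0)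
    {x : ℝ} {qx : Pair} {w : Pair × Pair} (hσ : (x, w.1, qx, w.2) ∈ S) :
    baseMultiplier α F S w = siteMultiplier α F (x, w.1, qx, w.2) := by
  have hex : ∃ p : ℝ × Pair, (p.1, w.1, p.2, w.2) ∈ S := ⟨(x, qx), hσ⟩
  rw [baseMultiplier, dif_pos hex]
  have hline : ∀ p : ℝ × Pair, HasFDerivAt (fun p : ℝ × Pair => ((p.1, w.1, p.2, w.2) : Site))
      ((ContinuousLinearMap.fst ℝ ℝ Pair).prod ((0 : ℝ × Pair →L[ℝ] Pair).prod
        ((ContinuousLinearMap.snd ℝ ℝ Pair).prod (0 : ℝ × Pair →L[ℝ] Pair)))) p := fun p =>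
    hasFDerivAt_fst.prodMk ((hasFDerivAt_const w.1 p).prodMk
      (hasFDerivAt_snd.prodMk (hasFDerivAt_const w.2 p)))
  have hd' : ∀ p ∈ {p : ℝ × Pair | (p.1, w.1, p.2, w.2) ∈ S},
      HasFDerivAt (fun p : ℝ × Pair => siteMultiplier α F (p.1, w.1, p.2, w.2))
        (0 : ℝ × Pair →L[ℝ] ℝ) p := by
    intro p hp
    have h1 := ((hd.differentiableAt (hS.mem_nhds hp)).hasFDerivAt).comp p (hline p)
    convert! h1 using 1
    exact ContinuousLinearMap.ext fun y => (h0 _ hp _ _).symm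
  exact (hS.preimage (f := fun p : ℝ × Pair => ((p.1, w.1, p.2, w.2) : Site))
    (by fun_prop)).is_const_of_fderiv_eq_zero (hfib w.1 w.2)
    (fun p hp => (hd' p hp).differentiableAt.differentiableWithinAt)
    (fun p hp => (hd' p hp).fderiv) (x := hex.choose) (y := (x, qx)) hex.choose_spec hσ

/-- If `I₁` and `J₁` are `n`-integrals, the system has the explicit form. -/
theorem exists_form_of_isNIntegral (hα : α ≠ 0) (hΩ_open : ∀ n, IsOpen (Ω n))
    (hΩ_fibre : ∀ (n : ℕ) (q q₁ : Pair), IsPreconnected {p : ℝ × Pair | (p.1, q, p.2, q₁) ∈ Ω n})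
    (hΩ_pos : ∀ n, ∀ σ ∈ Ω n,
      0 < σ.2.2.1.1 / (σ.2.1.1 + σ.2.1.2) ∧ σ.2.2.2.1 + σ.2.2.2.2 ≠ 0)
    (hf : ∀ n, ContDiffOn ℝ ∞ (f n) (Ω n)) (hg : ∀ n, ContDiffOn ℝ ∞ (g n) (Ω n))
    (hI : IsNIntegral f g Ω domI (I₁ α)) (hJ : IsNIntegral f g Ω domJ (J₁ α)) (n : ℕ) :
    ∃ D : Pair × Pair → ℝ, ContDiffOn ℝ ∞ D (baseOf (Ω n)) ∧ (∀ w ∈ baseOf (Ω n), 0 < D w) ∧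
      HasForm α (f n) (g n) (Ω n) D ∧ ∀ w ∈ baseOf (Ω n), SolvesPDE α D w := by
  have hS := hΩ_open n
  have hIσ := fun σ (hσ : σ ∈ Ω n) => hI.site_eq hS (hΩ_pos n) (hf n) (hg n) hσ
  have hpos : ∀ σ ∈ Ω n, 0 < σ.2.2.1.1 / (σ.2.1.1 + σ.2.1.2) ∧
      0 < f n σ / (σ.2.2.2.1 + σ.2.2.2.2) := fun σ hσ => ⟨(hΩ_pos n σ hσ).1, (hIσ σ hσ).1⟩
  have hfields := fun σ (hσ : σ ∈ Ω n) => fderiv_siteMultiplier_fields hα hS hpos (hf n)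
    (fun σ hσ => (hIσ σ hσ).2)
    (fun σ hσ => hJ.fderiv_siteMultiplier hα hS hpos (hf n) (hg n) hσ) hσ
  have hsm := contDiffOn_siteMultiplier (α := α) hpos (hf n)
  set D := baseMultiplier α (f n) (Ω n) with hD
  have hDeq : ∀ {x qx} {w : Pair × Pair}, (x, w.1, qx, w.2) ∈ Ω n →
      D w = siteMultiplier α (f n) (x, w.1, qx, w.2) := fun h =>
    baseMultiplier_eq hS (hΩ_fibre n) (hsm.differentiableOn (by simp))
      (fun σ hσ => (hfields σ hσ).1) h
  have hev : ∀ {x qx} {w : Pair × Pair}, (x, w.1, qx, w.2) ∈ Ω n →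
      D =ᶠ[𝓝 w] fun w => siteMultiplier α (f n) (x, w.1, qx, w.2) := by
    intro x qx w h
    have ho : IsOpen ((fun w : Pair × Pair => ((x, w.1, qx, w.2) : Site)) ⁻¹' Ω n) :=
      hS.preimage (by fun_prop)
    filter_upwards [ho.mem_nhds h] with w' hw'
    exact hDeq hw'
  have hfd : ∀ {x qx} {w : Pair × Pair}, (x, w.1, qx, w.2) ∈ Ω n → ∀ ξ,
      fderiv ℝ D w ξ = fderiv ℝ (siteMultiplier α (f n)) (x, w.1, qx, w.2) (siteIncl ξ) := by
    intro x qx w h ξ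
    have hline : HasFDerivAt (fun w : Pair × Pair => ((x, w.1, qx, w.2) : Site)) siteIncl w :=
      (hasFDerivAt_const x w).prodMk (hasFDerivAt_fst.prodMk
        ((hasFDerivAt_const qx w).prodMk hasFDerivAt_snd))
    have h1 := (((hsm.contDiffAt (hS.mem_nhds h)).differentiableAt
      (by simp)).hasFDerivAt.comp w hline).congr_of_eventuallyEq (hev h)
    rw [h1.fderiv]
    rfl
  refine ⟨D, ?_, ?_, ?_, ?_⟩
  · rintro w ⟨x, qx, h⟩
    refine ContDiffAt.contDiffWithinAt (ContDiffAt.congr_of_eventuallyEq ?_ (hev h))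
    exact ContDiffAt.comp w (f := fun w : Pair × Pair => ((x, w.1, qx, w.2) : Site))
      (hsm.contDiffAt (hS.mem_nhds h)) (by fun_prop)
  · rintro w ⟨x, qx, h⟩
    rw [hDeq h]
    exact Real.rpow_pos_of_pos (div_pos (hpos _ h).2 (hpos _ h).1) _
  · intro x u v ux vx u₁ v₁ h
    have h1 := hDeq (w := ((u, v), (u₁, v₁))) h
    have h2 := hpos _ h
    have h3 := (hIσ _ h).2
    simp only at h1 h2 h3
    rw [← h1] at h3
    have huv : u + v ≠ 0 := by rintro h; simp [h] at h2
    have huv₁ : u₁ + v₁ ≠ 0 := by rintro h; simp [h] at h2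
    have hux : ux ≠ 0 := by rintro h; simp [h] at h2
    have hE : D ((u, v), (u₁, v₁)) ^ (1 / α) =
        f n (x, (u, v), (ux, vx), (u₁, v₁)) / (u₁ + v₁) / (ux / (u + v)) := by
      rw [h1, siteMultiplier, multiplier, ← Real.rpow_mul (div_pos h2.2 h2.1).le,
        mul_one_div_cancel hα, Real.rpow_one]
    constructor
    · rw [hE]
      field_simp
    · rw [h3, ← hE]
      field_simp
  · rintro w ⟨x, qx, h⟩
    obtain ⟨-, hX, hY⟩ := hfields _ h
    rw [← hDeq h] at hX hY
    exact ⟨(hfd h _).trans hX, (hfd h _).trans hY⟩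

end Necessity

section Sufficiency

variable {α : ℝ} {Ω : ℕ → Set Site} {f g : ℕ → Site → ℝ} {a b n : ℕ} {s : Set ℝ}
  {u v : ℕ → ℝ → ℝ} {x : ℝ} {D : ℕ → Pair × Pair → ℝ}

/-- For a system of the explicit form, `E` and `𝒟₁` are recovered from `u_{1x}`. -/
theorem HasForm.multiplier_eq (hα : α ≠ 0) {F G : Site → ℝ} {S : Set Site} {D : Pair × Pair → ℝ}
    (h : HasForm α F G S D) {σ : Site} (hσ : σ ∈ S)
    (hpos : 0 < σ.2.2.1.1 / (σ.2.1.1 + σ.2.1.2)) (hne : σ.2.2.2.1 + σ.2.2.2.2 ≠ 0)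
    (hD : 0 < D (σ.2.1, σ.2.2.2)) :
    0 < F σ / (σ.2.2.2.1 + σ.2.2.2.2) ∧
      (F σ / (σ.2.2.2.1 + σ.2.2.2.2)) / (σ.2.2.1.1 / (σ.2.1.1 + σ.2.1.2)) =
        D (σ.2.1, σ.2.2.2) ^ (1 / α) ∧
      siteMultiplier α F σ = D (σ.2.1, σ.2.2.2) := by
  obtain ⟨x, ⟨u, v⟩, ⟨ux, vx⟩, ⟨u₁, v₁⟩⟩ := σ
  have h1 := (h x u v ux vx u₁ v₁ hσ).1
  simp only at *
  have huv : u + v ≠ 0 := by rintro h; simp [h] at hpos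
  have hux : ux ≠ 0 := by rintro h; simp [h] at hpos
  have hE : 0 < D ((u, v), (u₁, v₁)) ^ (1 / α) := by positivity
  have h2 : F (x, (u, v), (ux, vx), (u₁, v₁)) / (u₁ + v₁) =
      D ((u, v), (u₁, v₁)) ^ (1 / α) * (ux / (u + v)) := by
    rw [h1]; field_simp
  have h3 : F (x, (u, v), (ux, vx), (u₁, v₁)) / (u₁ + v₁) / (ux / (u + v)) =
      D ((u, v), (u₁, v₁)) ^ (1 / α) := by
    rw [h2, mul_div_assoc, div_self hpos.ne', mul_one]
  refine ⟨h2 ▸ mul_pos hE hpos, h3, ?_⟩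
  simp only [siteMultiplier, multiplier]
  rw [h3, ← Real.rpow_mul hD.le, one_div_mul_cancel hα, Real.rpow_one]

theorem isNIntegral_I₁_of_hasForm (hα : α ≠ 0)
    (hΩ_pos : ∀ n, ∀ σ ∈ Ω n,
      0 < σ.2.2.1.1 / (σ.2.1.1 + σ.2.1.2) ∧ σ.2.2.2.1 + σ.2.2.2.2 ≠ 0)
    (hpos : ∀ n, ∀ w ∈ baseOf (Ω n), 0 < D n w)
    (hform : ∀ n, HasForm α (f n) (g n) (Ω n) (D n)) : IsNIntegral f g Ω domI (I₁ α) := by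
  intro a b s u v hsol n hn x hx hdom
  have hσ := hsol.mem_domain n hn x hx
  obtain ⟨hp, hne⟩ := hΩ_pos n _ hσ
  obtain ⟨hp₁, hE, hδ⟩ := (hform n).multiplier_eq hα hσ hp hne (hpos n _ ⟨_, _, hσ⟩)
  have hp₁' : 0 < deriv (u (n + 1)) x / (u (n + 1) x + v (n + 1) x) := by
    rw [hsol.eq_u n hn x hx]
    exact hp₁
  refine ⟨hp₁', ?_⟩
  have hg := ((hform n) _ _ _ _ _ _ _ hσ).2
  refine (I₁_shift_iff (α := α) (p := deriv (u n) x / (u n x + v n x)) (v := v n x)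
    (v₁ := v (n + 1) x) (vx := deriv (v n) x) (r := deriv (v (n + 1)) x) hp hp₁').2 ?_
  rw [hsol.eq_u n hn x hx, hsol.eq_v n hn x hx]
  have hδ' : (f n (siteOf u v n x) / (u (n + 1) x + v (n + 1) x) /
      (deriv (u n) x / (u n x + v n x))) ^ α = D n ((u n x, v n x), (u (n + 1) x, v (n + 1) x)) :=
    hδ
  have hE' : f n (siteOf u v n x) / (u (n + 1) x + v (n + 1) x) /
      (deriv (u n) x / (u n x + v n x)) =
        D n ((u n x, v n x), (u (n + 1) x, v (n + 1) x)) ^ (1 / α) := hE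
  rw [hδ', hE']
  refine hg.trans ?_
  have huv : u n x + v n x ≠ 0 := by
    rintro h
    have h' := hdom
    simp [domI, jetOf, h] at h'
  field_simp

theorem isNIntegral_J₁_of_hasForm (hα : α ≠ 0) (hΩ_open : ∀ n, IsOpen (Ω n))
    (hΩ_pos : ∀ n, ∀ σ ∈ Ω n,
      0 < σ.2.2.1.1 / (σ.2.1.1 + σ.2.1.2) ∧ σ.2.2.2.1 + σ.2.2.2.2 ≠ 0)
    (hD : ∀ n, ContDiffOn ℝ ∞ (D n) (baseOf (Ω n)))
    (hpos : ∀ n, ∀ w ∈ baseOf (Ω n), 0 < D n w)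
    (hform : ∀ n, HasForm α (f n) (g n) (Ω n) (D n))
    (hpde : ∀ n, ∀ w ∈ baseOf (Ω n), SolvesPDE α (D n) w) : IsNIntegral f g Ω domJ (J₁ α) := by
  intro a b s u v hsol n hn x hx hdom
  have hmul := fun t (ht : t ∈ s) => (hform n).multiplier_eq hα (hsol.mem_domain n hn t ht)
    (hΩ_pos n _ (hsol.mem_domain n hn t ht)).1 (hΩ_pos n _ (hsol.mem_domain n hn t ht)).2
    (hpos n _ ⟨_, _, hsol.mem_domain n hn t ht⟩)
  have hσ := hsol.mem_domain n hn x hx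
  obtain ⟨hp, hne⟩ := hΩ_pos n _ hσ
  have hp₁ : 0 < deriv (u (n + 1)) x / (u (n + 1) x + v (n + 1) x) := by
    rw [hsol.eq_u n hn x hx]
    exact (hmul x hx).1
  have hux₁ : deriv (u (n + 1)) x ≠ 0 := by rintro h; simp [h] at hp₁
  refine ⟨⟨hux₁, hne⟩, ?_⟩
  have hn0 : n ∈ Icc a b := Ico_subset_Icc_self hn
  have hn1 : n + 1 ∈ Icc a b := ⟨hn.1.trans (Nat.le_succ n), hn.2⟩
  set w : Pair × Pair := ((u n x, v n x), (u (n + 1) x, v (n + 1) x)) with hw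
  have hwb : w ∈ baseOf (Ω n) := ⟨_, _, hσ⟩
  have hcurve : HasDerivAt (fun t => (((u n t, v n t), (u (n + 1) t, v (n + 1) t)) : Pair × Pair))
      ((deriv (u n) x, deriv (v n) x), (deriv (u (n + 1)) x, deriv (v (n + 1)) x)) x :=
    ((hasDerivAt_of_contDiffOn_two hsol.isOpen (hsol.contDiffOn_u n hn0) hx).1.prodMk
      (hasDerivAt_of_contDiffOn_two hsol.isOpen (hsol.contDiffOn_v n hn0) hx).1).prodMk
    ((hasDerivAt_of_contDiffOn_two hsol.isOpen (hsol.contDiffOn_u _ hn1) hx).1.prodMk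
      (hasDerivAt_of_contDiffOn_two hsol.isOpen (hsol.contDiffOn_v _ hn1) hx).1)
  have hDw : HasFDerivAt (D n) (fderiv ℝ (D n) w) w :=
    (((hD n).contDiffAt ((isOpen_baseOf (hΩ_open n)).mem_nhds hwb)).differentiableAt
      (by simp)).hasFDerivAt
  have hδ := (hDw.comp_hasDerivAt x hcurve).congr_of_eventuallyEq
    (f₁ := fun t => siteMultiplier α (f n) (siteOf u v n t)) (by
      filter_upwards [hsol.isOpen.mem_nhds hx] with t ht
      exact (hmul t ht).2.2)
  refine (J₁_jetOf_shift_iff hα hsol hn hx hp hp₁ hδ).2 ?_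
  have hDx : siteMultiplier α (f n) (siteOf u v n x) = D n w := (hmul x hx).2.2
  rw [hDx, ← (hpde n w hwb).eq_Y, ← smul_eq_mul, ← map_smul]
  have hX := (hpde n w hwb).eq_X
  -- The velocity of the solution is the combination `p Y + v_x X` of the two fields.
  have hvel : ((deriv (u n) x, deriv (v n) x), (deriv (u (n + 1)) x, deriv (v (n + 1)) x)) =
      (deriv (u n) x / (u n x + v n x)) • fieldY α w (D n w) +
        deriv (v n) x • fieldX (D n w) := by
    have huv : u n x + v n x ≠ 0 := hdom.2
    rw [hsol.eq_u n hn x hx, hsol.eq_v n hn x hx, siteOf, ((hform n) _ _ _ _ _ _ _ hσ).1,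
      ((hform n) _ _ _ _ _ _ _ hσ).2]
    simp only [fieldX, fieldY, Prod.smul_mk, Prod.mk_add_mk, smul_eq_mul, mul_zero, add_zero,
      zero_add, mul_one, Prod.mk.injEq, hw, and_true]
    refine ⟨?_, ?_, ?_⟩ <;> field_simp
  rw [hvel, map_add, map_smul _ (deriv (v n) x), hX, smul_zero, add_zero]

end Sufficiency

end SemiDiscrete

end

open SemiDiscrete in
theorem theorem1 (α : ℝ) (hα0 : α ≠ 0) (hα1 : α ≠ 1)
    (Ω : ℕ → Set Site) (f g : ℕ → Site → ℝ)
    (hΩ_open : ∀ n, IsOpen (Ω n))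
    (hΩ_fibre : ∀ (n : ℕ) (q q₁ : Pair),
      IsPreconnected {p : ℝ × Pair | (p.1, q, p.2, q₁) ∈ Ω n})
    (hΩ_pos : ∀ (n : ℕ) (x u v ux vx u₁ v₁ : ℝ), (x, (u, v), (ux, vx), (u₁, v₁)) ∈ Ω n →
      0 < ux / (u + v) ∧ u₁ + v₁ ≠ 0)
    (hf : ∀ n, ContDiffOn ℝ ∞ (f n) (Ω n))
    (hg : ∀ n, ContDiffOn ℝ ∞ (g n) (Ω n)) :
    (IsNIntegral f g Ω domI (I₁ α) ∧ IsNIntegral f g Ω domJ (J₁ α)) ↔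
      ∃ D : ℕ → Pair × Pair → ℝ, ∀ n,
        ContDiffOn ℝ ∞ (D n) (baseOf (Ω n)) ∧
        (∀ w ∈ baseOf (Ω n), 0 < D n w) ∧
        HasForm α (f n) (g n) (Ω n) (D n) ∧
        ∀ w ∈ baseOf (Ω n),
          D n w = 1 ∨ ∃ H : ℝ × ℝ → ℝ, ContDiff ℝ ∞ H ∧ IsImplicitNear α H (D n) w := by
  have hpos : ∀ n, ∀ σ ∈ Ω n,
      0 < σ.2.2.1.1 / (σ.2.1.1 + σ.2.1.2) ∧ σ.2.2.2.1 + σ.2.2.2.2 ≠ 0 :=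
    fun n σ hσ => hΩ_pos n _ _ _ _ _ _ _ hσ
  constructor
  · rintro ⟨hI, hJ⟩
    choose D hD hDpos hform hpde using
      exists_form_of_isNIntegral hα0 hΩ_open hΩ_fibre hpos hf hg hI hJ
    refine ⟨D, fun n => ⟨hD n, hDpos n, hform n, fun w hw => or_iff_not_imp_left.2 fun h1 => ?_⟩⟩
    have hnear : ∀ᶠ y in 𝓝 w, y ∈ baseOf (Ω n) := (isOpen_baseOf (hΩ_open n)).mem_nhds hw
    exact exists_isImplicitNear hα0
      (hnear.mono fun y hy => (hD n).contDiffAt ((isOpen_baseOf (hΩ_open n)).mem_nhds hy))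
      (hDpos n w hw) h1 (hnear.mono fun y hy => hpde n y hy)
  · rintro ⟨D, h⟩
    exact ⟨isNIntegral_I₁_of_hasForm hα0 hpos (fun n => (h n).2.1) fun n => (h n).2.2.1,
      isNIntegral_J₁_of_hasForm hα0 hΩ_open hpos (fun n => (h n).1) (fun n => (h n).2.1)
        (fun n => (h n).2.2.1) fun n => solvesPDE_of_eq_one_or_implicit hα0
          (isOpen_baseOf (hΩ_open n)) (h n).1 (h n).2.1 (h n).2.2.2⟩
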